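/- **Proposition (Mass conservation of the ETDRK2 scheme).** Let $d\ge 1$ and let either $\Omega=\prod_{i=1}^d(a_i,b_i)$ with $a_i<b_i$, with periodic boundary conditions, or $\Omega\subset\mathbb R^d$ be a bounded, open, connected, non-empty set, with the homogeneous Neumann boundary condition. Let $X=C(\overline\Omega)$ in the Neumann case, and let $X$ be the subspace of the functions in $C(\overline\Omega)$ that agree on opposite faces in the periodic case. The Laplacian $\Delta$ with the boundary condition is understood variationally: $\Delta u=l$ means that $u\in X\cap V$, $l\in X$ and $\int_\Omega\nabla u\cdot\nabla v\,d\mathbf x=-\int_\Omega l\,v\,d\mathbf x$ for all $v\in V$, where $V=H^1(\Omega)$ (Neumann) or $V=H^1_{\rm per}(\Omega)$ (periodic). Let $\varepsilon,\kappa,\tau>0$, $f(y)=y-y^3$, $g(y)=1-y^2$, $$\lambda_u=\frac{\int_\Omega f(u)\,d\mathbf x}{\int_\Omega g(u)\,d\mathbf x},\qquad \mathcal N[u]=\kappa u+f(u)-\lambda_u\,g(u),\qquad \mathcal L_\kappa=\varepsilon^2\Delta-\kappa\mathcal I .$$ Let $u_0\in X$ and $M_0=\int_\Omega u_0\,d\mathbf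 x$. Let $(u^n)_{n\ge0}$, with $u^0=u_0$, and $(\tilde u^{n+1})_{n\ge0}$ be generated by the ETDRK2 scheme with time step $\tau$: for every $n\ge 0$, $\tilde u^{n+1}=\tilde w^n(\tau)$ and $u^{n+1}=w^n(\tau)$, where $\tilde w^n(0)=w^n(0)=u^n$ and, for $s\in(0,\tau]$ and in $\Omega$, $$\partial_s \tilde w^n=\mathcal L_\kappa \tilde w^n+\mathcal N[u^n],\qquad \partial_s w^n=\mathcal L_\kappa w^n+\Big(1-\frac s\tau\Big)\mathcal N[u^n]+\frac s\tau\,\mathcal N[\tilde u^{n+1}],$$ with the given boundary condition. (Solutions are continuous on $[0,\tau]\times\overline\Omega$ and have a Laplacian, in the sense above, that is continuous on $(0,\tau]\times\overline\Omega$.) 1. If the scheme is defined, that is, if $\int_\Omega g(u^n)\,d\mathbf x\ne0$ and $\int_\Omega g(\tilde u^{n+1})\,d\mathbf x\neq0$ for all $n\ge0$, then for any time step $\tau>0$ $$\int_\Omega u^n\,d\mathbf x=M_0\qquad\text{for all } n\ge 0 .$$ 2. Under the standing assumptions $\kappa\ge4$, $\|u_0\|_{C(\overline\Omega)}\le1$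 and $|M_0|\ne|\Omega|$, for any time step $\tau>0$ these denominators never vanish, and hence $\int_\Omega u^n\,d\mathbf x=M_0$ for all $n\ge 0$. (If a quotient $\lambda_u$ occurring in the scheme had denominator zero it would be read as $0$; the claim includes that this does not happen.) -/

import Mathlib

open MeasureTheory
open scoped ContDiff

namespace MassAC

/-- Points of `ℝ^d`. -/
abbrev Pt (d : ℕ) : Type := EuclideanSpace ℝ (Fin d)

/-- The `i`-th coordinate vector of `ℝ^d`. -/
noncomputable def coordVec {d : ℕ} (i : Fin d) : Pt d := EuclideanSpace.single i (1 : ℝ)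

/-- A spatial domain together with its boundary condition: either the box `∏ (aᵢ, bᵢ)` with periodic
boundary conditions, or a domain `Ω` with the homogeneous Neumann boundary condition. -/
inductive BVSetting (d : ℕ) : Type where
  | periodic (a b : Fin d → ℝ) : BVSetting d
  | neumann (Ω : Set (Pt d)) : BVSetting d

namespace BVSetting

variable {d : ℕ}

/-- The (open) spatial domain. -/
def dom : BVSetting d → Set (Pt d)
  | periodic a b => {x | ∀ i, a i < x i ∧ x i < b i}
  | neumann Ω => Ω

/-- Periodic case: the box is non-degenerate. Neumann case: `Ω` is open, connected (in particular
non-empty) and bounded. -/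
def IsAdmissible : BVSetting d → Prop
  | periodic a b => ∀ i, a i < b i
  | neumann Ω => IsOpen Ω ∧ IsConnected Ω ∧ Bornology.IsBounded Ω

/-- In the periodic case, the values on opposite faces of the closed box agree; no condition in the
Neumann case (there the boundary condition is carried by the Laplacian, see `IsLaplacian`). -/
def MatchesOnFaces : BVSetting d → (Pt d → ℝ) → Prop
  | periodic a b, u => ∀ x ∈ closure (periodic a b).dom, ∀ i, x i = a i →
      u (x + (b i - a i) • coordVec i) = u x
  | neumann _, _ => True

/-- The state space: `C(Ω̄)` in the Neumann case, and its subspace of periodic functions in the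
periodic case. Only the values on `Ω̄` of a function matter. -/
def IsState (S : BVSetting d) (u : Pt d → ℝ) : Prop :=
  ContinuousOn u (closure S.dom) ∧ S.MatchesOnFaces u

/-- Test functions: smooth functions that are periodic with respect to the box, respectively smooth
functions with compact support in `Ω`. -/
def IsTest : BVSetting d → (Pt d → ℝ) → Prop
  | periodic a b, φ => ContDiff ℝ ∞ φ ∧ ∀ i x, φ (x + (b i - a i) • coordVec i) = φ x
  | neumann Ω, φ => ContDiff ℝ ∞ φ ∧ HasCompactSupport φ ∧ tsupport φ ⊆ Ω

/-- `v` belongs to `H¹(Ω)` (Neumann case), respectively to `H¹_per(Ω)`, the `H¹` space of the torus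
(periodic case), and has weak gradient `G`: both are square integrable on `Ω`, and
`∫_Ω v ∂ᵢφ = - ∫_Ω Gᵢ φ` for all test functions `φ` and all `i`. -/
def HasWeakGradient (S : BVSetting d) (v : Pt d → ℝ) (G : Pt d → Pt d) : Prop :=
  MemLp v 2 (volume.restrict S.dom) ∧ MemLp G 2 (volume.restrict S.dom) ∧
    ∀ φ : Pt d → ℝ, S.IsTest φ → ∀ i : Fin d,
      ∫ x in S.dom, v x * fderiv ℝ φ x (coordVec i) = -∫ x in S.dom, G x i * φ x

/-- `u` lies in the domain of the Laplace operator on the state space, subject to the periodic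
respectively homogeneous Neumann boundary condition, and `Δ u = l`. This is the usual variational
realisation (the one that is meaningful on Lipschitz domains, where the normal exists only almost
everywhere and the gradient need not extend to the boundary): `u` and `l` are states, `u` is in
`H¹`, and `∫_Ω ∇u · ∇v = - ∫_Ω l v` for every `v` in `H¹` (respectively `H¹_per`). For `u` regular
up to the boundary the identity is Green's formula, and it says that `Δ u = l` in `Ω` and
`∂u/∂n = 0` on `∂Ω` (respectively that `u` and its normal derivatives match on opposite faces). -/
def IsLaplacian (S : BVSetting d) (u l : Pt d → ℝ) : Prop :=
  S.IsState u ∧ S.IsState l ∧ ∃ G : Pt d → Pt d, S.HasWeakGradient u G ∧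
    ∀ (v : Pt d → ℝ) (H : Pt d → Pt d), S.HasWeakGradient v H →
      ∫ x in S.dom, inner ℝ (G x) (H x) = -∫ x in S.dom, l x * v x

end BVSetting

/-- `f(y) = y - y³`. -/
def fAC (y : ℝ) : ℝ := y - y ^ 3

/-- `g(y) = 1 - y²`. -/
def gAC (y : ℝ) : ℝ := 1 - y ^ 2

variable {d : ℕ}

/-- `∫_Ω g(u)`, the denominator of the Lagrange multiplier. -/
noncomputable def gMass (S : BVSetting d) (u : Pt d → ℝ) : ℝ := ∫ x in S.dom, gAC (u x)

/-- The Lagrange multiplier `λ_u = ∫_Ω f(u) / ∫_Ω g(u)`; meaningful when `gMass S u ≠ 0`. -/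
noncomputable def multiplier (S : BVSetting d) (u : Pt d → ℝ) : ℝ :=
  (∫ x in S.dom, fAC (u x)) / gMass S u

/-- `N[u] = κ u + f(u) - λ_u g(u)`. -/
noncomputable def nonlin (S : BVSetting d) (κ : ℝ) (u : Pt d → ℝ) (x : Pt d) : ℝ :=
  κ * u x + fAC (u x) - multiplier S u * gAC (u x)

/-- One exponential time differencing step of size `τ` with source `F`: on `Ω̄` one has
`v = w(τ)`, where `w` is a solution of `∂_s w = ε² Δ w - κ w + F` in `Ω`, `s ∈ (0, τ]`,
`w(0) = u`, subject to the boundary condition of `S`. Here `w` is continuous on `[0, τ] × Ω̄`, and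
`l = Δ w` (hence also `∂_s w`, for continuous `F`) is continuous on `(0, τ] × Ω̄`; at `s = τ` the
time derivative is the one from the left. -/
def IsETDStep (S : BVSetting d) (ε κ τ : ℝ) (F : ℝ → Pt d → ℝ) (u v : Pt d → ℝ) : Prop :=
  ∃ w l : ℝ → Pt d → ℝ,
    ContinuousOn (fun p : ℝ × Pt d => w p.1 p.2) (Set.Icc 0 τ ×ˢ closure S.dom) ∧
    ContinuousOn (fun p : ℝ × Pt d => l p.1 p.2) (Set.Ioc 0 τ ×ˢ closure S.dom) ∧
    (∀ s ∈ Set.Ioc 0 τ, S.IsLaplacian (w s) (l s)) ∧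
    (∀ s ∈ Set.Ioc 0 τ, ∀ x ∈ S.dom,
      HasDerivWithinAt (fun r => w r x) (ε ^ 2 * l s x - κ * w s x + F s x) (Set.Icc 0 τ) s) ∧
    (∀ x ∈ closure S.dom, w 0 x = u x) ∧
    (∀ x ∈ closure S.dom, v x = w τ x)

/-- `u 0, u 1, …` are the iterates of the ETDRK2 scheme with initial value `u₀`, and `p (n + 1)` is
the predictor that the ETD1 scheme produces from `u n` (the value `p 0` plays no role). -/
structure IsETDRK2 (S : BVSetting d) (ε κ τ : ℝ) (u₀ : Pt d → ℝ) (u p : ℕ → Pt d → ℝ) : Prop where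
  init : ∀ x ∈ closure S.dom, u 0 x = u₀ x
  predictor : ∀ n, IsETDStep S ε κ τ (fun _ => nonlin S κ (u n)) (u n) (p (n + 1))
  corrector : ∀ n, IsETDStep S ε κ τ
    (fun s x => (1 - s / τ) * nonlin S κ (u n) x + s / τ * nonlin S κ (p (n + 1)) x)
    (u n) (u (n + 1))

/-- All nonlinear terms that occur in the scheme are defined: no denominator `∫_Ω g` vanishes. -/
def NonlinDefined (S : BVSetting d) (u p : ℕ → Pt d → ℝ) : Prop :=
  ∀ n, gMass S (u n) ≠ 0 ∧ gMass S (p (n + 1)) ≠ 0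

end MassAC

/-!
Both exponential steps solve `∂ₛ w = ε² Δ w - κ w + F` on `[0, τ]` with `w(0) = uⁿ`. Two tests of
this equation prove everything.

*Mass.* Testing with the constant `1` removes the Laplacian, and the multiplier is chosen such that
`∫ N[u] = κ ∫ u` whenever its denominator is nonzero. Hence `m(s) = ∫ w(s)` solves
`m' = -κ (m - m(0))`, so `m` is constant (`IsETDStep.integral_eq`); for the corrector the source
interpolates between two terms with integral `κ ∫ uⁿ`.

*Maximum bound.* If `|u| ≤ 1`, then `|λ_u| ≤ 1` because `f(y) = y g(y)`, and for `κ ≥ 4` this gives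
`|N[u]| ≤ κ` (`abs_nonlin_le`). For a convex `Φ` that vanishes exactly on `[-1, 1]`, with
derivative `η`, testing with `η(w)` gives `d/ds ∫ Φ(w) ≤ ∫ η(w) (F - κ w) ≤ 0` if `|F| ≤ κ`, since
`∫ η(w) Δ w = -∫ η'(w) |∇w|² ≤ 0`. So the bound `|u| ≤ 1` is propagated by each step
(`IsETDStep.abs_le_one`). Then `∫ g(u) = 0` would force `u² = 1` on the connected set `Ω`, that is
`u = 1` or `u = -1`, and the conserved mass would be `±|Ω|` (`gMass_ne_zero`).

The analytic input is that `η(w)` is admissible as a test function, i.e. the chain rule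
`∇ η(w) = η'(w) ∇w` in `H¹(Ω)` for an arbitrary open set, and in `H¹_per`
(`BVSetting.HasWeakGradient.comp`). On an open set (`IsWeakDerivOn.comp`) it follows from difference
quotients: almost everywhere the increment `w(x + v) - w(x)` is the integral of the weak derivative
over the segment, the increment of `η(w)` is a bounded quotient times it, and after the translations
have been moved to the bounded factor the limit is taken by dominated convergence. The periodic case
reduces to the whole space: a periodic weak derivative is the same as a weak derivative of the
periodic extension (`BVSetting.isWeakDerivOn_fold_iff`), because periodic test functions are exactly
the periodizations of smooth functions with compact support (`exists_periodize_eq`).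
-/

namespace MassAC

/-! ### Chain rule for weak derivatives on open sets -/

section ChainRule

open Filter Topology

/-- Lebesgue measure on the time interval `(0, 1]` times `μ`. -/
noncomputable def unitProd {E : Type*} [MeasurableSpace E] (μ : Measure E) : Measure (ℝ × E) :=
  (volume.restrict (Set.Ioc (0 : ℝ) 1)).prod μ

lemma ae_unitProd_mem {E : Type*} [MeasurableSpace E] {μ : Measure E} :
    ∀ᵐ p ∂(unitProd μ), p.1 ∈ Set.Ioc (0 : ℝ) 1 := by
  have h : ∀ᵐ t ∂(volume.restrict (Set.Ioc (0 : ℝ) 1)), t ∈ Set.Ioc (0 : ℝ) 1 :=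
    ae_restrict_mem measurableSet_Ioc
  exact Measure.quasiMeasurePreserving_fst.ae h

lemma norm_mul_le_indicator {E : Type*} {g : E → ℝ} {K : Set E} {C y : ℝ} {x : E} (hy : |y| ≤ C)
    (h0 : x ∉ K → y = 0) : ‖g x * y‖ ≤ C * ‖K.indicator g x‖ := by
  by_cases hx : x ∈ K
  · rw [Set.indicator_of_mem hx, norm_mul, mul_comm]
    exact mul_le_mul_of_nonneg_right hy (norm_nonneg _)
  · simp [h0 hx, hx]

/-- Compactness of the set swept out by a compact set that is translated along a segment. -/
lemma isCompact_sweep {E : Type*} [NormedAddCommGroup E] [NormedSpace ℝ E] {K : Set E}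
    (hK : IsCompact K) (v : E) :
    IsCompact ((fun p : ℝ × E => p.2 + p.1 • v) '' (Set.Icc (0 : ℝ) 1 ×ˢ K)) :=
  (isCompact_Icc.prod hK).image (by fun_prop)

lemma notMem_of_notMem_sweep {E : Type*} [NormedAddCommGroup E] [NormedSpace ℝ E] {K : Set E}
    {v x : E} {t : ℝ} (ht : t ∈ Set.Icc (0 : ℝ) 1)
    (hx : x ∉ (fun p : ℝ × E => p.2 + p.1 • v) '' (Set.Icc (0 : ℝ) 1 ×ˢ K)) :
    x - t • v ∉ K := fun h => hx ⟨(t, x - t • v), ⟨ht, h⟩, by simp⟩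

lemma tsupport_translate_subset {E : Type*} [NormedAddCommGroup E] {φ : E → ℝ} (w : E)
    {x : E} (hx : x ∈ tsupport (fun x => φ (x - w))) : x - w ∈ tsupport φ := by
  have h := tsupport_comp_subset_preimage φ (f := fun x : E => x - w) (by fun_prop)
  exact h hx

variable {E : Type*} [NormedAddCommGroup E] [NormedSpace ℝ E] [FiniteDimensional ℝ E]
  [MeasurableSpace E] [BorelSpace E] {μ : Measure E} [μ.IsAddHaarMeasure]

/-- `g` is the weak derivative of `W` in the direction `e` on the open set `U`, both functions being
given on the whole space and tested against smooth functions with compact support in `U`. -/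
def IsWeakDerivOn (μ : Measure E) (U : Set E) (W g : E → ℝ) (e : E) : Prop :=
  ∀ φ : E → ℝ, ContDiff ℝ ∞ φ → HasCompactSupport φ → tsupport φ ⊆ U →
    ∫ x, W x * fderiv ℝ φ x e ∂μ = -∫ x, g x * φ x ∂μ

/-- The dominating function for all integrals over `unitProd μ` of the form `∫ g Ψ`. -/
lemma integrable_unitProd_bound {g : E → ℝ} (hg : LocallyIntegrable g μ) {K : Set E}
    (hK : IsCompact K) (C : ℝ) :
    Integrable (fun p : ℝ × E => C * ‖K.indicator g p.2‖) (unitProd μ) := by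
  have h1 : Integrable (K.indicator g) μ :=
    (hg.integrableOn_isCompact hK).integrable_indicator hK.measurableSet
  exact (h1.norm.comp_snd (volume.restrict (Set.Ioc (0 : ℝ) 1))).const_mul C

lemma integrable_unitProd {g : E → ℝ} (hg : LocallyIntegrable g μ) (hgm : Measurable g)
    {K : Set E} (hK : IsCompact K) {C : ℝ} {Ψ : ℝ × E → ℝ} (hΨ : Measurable Ψ)
    (hC : ∀ p, |Ψ p| ≤ C) (h0 : ∀ p, p.1 ∈ Set.Ioc (0 : ℝ) 1 → p.2 ∉ K → Ψ p = 0) :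
    Integrable (fun p : ℝ × E => g p.2 * Ψ p) (unitProd μ) := by
  refine (integrable_unitProd_bound hg hK C).mono'
    ((hgm.comp measurable_snd).mul hΨ).aestronglyMeasurable ?_
  filter_upwards [ae_unitProd_mem] with p hp
  exact norm_mul_le_indicator (hC p) (h0 p hp)

/-- Dominated convergence for averages over `t ∈ (0, 1]` whose limit does not depend on `t`. -/
lemma tendsto_integral_unitProd {g : E → ℝ} (hg : LocallyIntegrable g μ) (hgm : Measurable g)
    {K : Set E} (hK : IsCompact K) {C : ℝ} {Ψ : ℕ → ℝ × E → ℝ} (hΨ : ∀ n, Measurable (Ψ n))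
    (hC : ∀ n p, |Ψ n p| ≤ C) (h0 : ∀ n p, p.1 ∈ Set.Ioc (0 : ℝ) 1 → p.2 ∉ K → Ψ n p = 0)
    {Φ : E → ℝ} (hlim : ∀ᵐ x ∂μ, ∀ t, Tendsto (fun n => Ψ n (t, x)) atTop (𝓝 (Φ x))) :
    Tendsto (fun n => ∫ p, g p.2 * Ψ n p ∂(unitProd μ)) atTop (𝓝 (∫ x, g x * Φ x ∂μ)) := by
  have h1 : ∫ x, g x * Φ x ∂μ = ∫ p : ℝ × E, g p.2 * Φ p.2 ∂(unitProd μ) := by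
    rw [unitProd, integral_fun_snd (fun x => g x * Φ x)]
    simp
  rw [h1]
  refine tendsto_integral_of_dominated_convergence (fun p => C * ‖K.indicator g p.2‖)
    (fun n => ((hgm.comp measurable_snd).mul (hΨ n)).aestronglyMeasurable)
    (integrable_unitProd_bound hg hK C) (fun n => ?_) ?_
  · filter_upwards [ae_unitProd_mem] with p hp
    exact norm_mul_le_indicator (hC n p) (h0 n p hp)
  · have := (Measure.quasiMeasurePreserving_snd
      (μ := volume.restrict (Set.Ioc (0 : ℝ) 1)) (ν := μ)).ae hlim
    filter_upwards [this] with p hp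
    exact (hp p.1).const_mul _

lemma measurePreserving_shear (v : E) :
    MeasurePreserving (fun p : ℝ × E => (p.1, p.2 + p.1 • v)) (unitProd μ) (unitProd μ) := by
  refine (MeasurePreserving.id _).skew_product (g := fun t x => x + t • v) ?_ ?_
  · exact (measurable_snd.add (measurable_fst.smul_const v))
  · exact Eventually.of_forall fun t => map_add_right_eq_self μ (t • v)

lemma measurableEmbedding_shear (v : E) :
    MeasurableEmbedding (fun p : ℝ × E => (p.1, p.2 + p.1 • v)) := by
  have hc : ∀ w : E, Measurable (fun p : ℝ × E => (p.1, p.2 + p.1 • w)) := fun w =>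
    measurable_fst.prodMk (measurable_snd.add (measurable_fst.smul_const w))
  let e : (ℝ × E) ≃ᵐ (ℝ × E) :=
    { toFun := fun p => (p.1, p.2 + p.1 • v)
      invFun := fun p => (p.1, p.2 + p.1 • (-v))
      left_inv := fun p => by simp
      right_inv := fun p => by simp
      measurable_toFun := hc v
      measurable_invFun := hc (-v) }
  exact e.measurableEmbedding

/-- The increment of a smooth test function, as an average of its derivative along the segment. -/
lemma integral_mul_translate_sub {B : E → ℝ} (hB : LocallyIntegrable B μ) (hBm : Measurable B)
    {φ : E → ℝ} (hφ : ContDiff ℝ ∞ φ) (hc : HasCompactSupport φ) (v : E) :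
    ∫ x, B x * (φ (x - v) - φ x) ∂μ =
      -∫ p : ℝ × E, B p.2 * fderiv ℝ φ (p.2 - p.1 • v) v ∂(unitProd μ) := by
  have hd : Continuous (fun x => fderiv ℝ φ x v) :=
    (hφ.continuous_fderiv (by simp)).clm_apply continuous_const
  have hdc : HasCompactSupport (fun x => fderiv ℝ φ x v) := hc.fderiv_apply ℝ v
  obtain ⟨C, hC⟩ := hdc.exists_bound_of_continuous hd
  have hint : Integrable (fun p : ℝ × E => B p.2 * fderiv ℝ φ (p.2 - p.1 • v) v)
      (unitProd μ) := by
    refine integrable_unitProd hB hBm (isCompact_sweep hdc v) (C := C)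
      (Ψ := fun p => fderiv ℝ φ (p.2 - p.1 • v) v) ?_ (fun p => hC _) ?_
    · exact (hd.comp (by fun_prop : Continuous fun p : ℝ × E => p.2 - p.1 • v)).measurable
    · intro p hp hx
      exact image_eq_zero_of_notMem_tsupport
        (f := fun x => fderiv ℝ φ x v)
        (notMem_of_notMem_sweep (Set.Ioc_subset_Icc_self hp) hx)
  rw [unitProd, integral_prod_symm _ hint, ← integral_neg]
  refine integral_congr_ae (Eventually.of_forall fun x => ?_)
  have hline : ∀ t : ℝ, HasDerivAt (fun t : ℝ => φ (x - t • v)) (-fderiv ℝ φ (x - t • v) v) t := by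
    intro t
    have h1 : HasDerivAt (fun t : ℝ => x - t • v) (-v) t := by
      simpa using ((hasDerivAt_id t).smul_const v).const_sub x
    have h2 := ((hφ.differentiable (by simp)) (x - t • v)).hasFDerivAt.comp_hasDerivAt t h1
    simpa [Function.comp_def] using h2
  have hcont : Continuous (fun t : ℝ => -fderiv ℝ φ (x - t • v) v) :=
    (hd.comp (by fun_prop : Continuous fun t : ℝ => x - t • v)).neg
  have hftc := intervalIntegral.integral_eq_sub_of_hasDerivAt (a := 0) (b := 1)
    (fun t _ => hline t) (hcont.intervalIntegrable _ _)
  simp only [one_smul, zero_smul, sub_zero] at hftc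
  rw [intervalIntegral.integral_of_le zero_le_one, integral_neg] at hftc
  show B x * (φ (x - v) - φ x) = -∫ t in Set.Ioc (0 : ℝ) 1, B x * fderiv ℝ φ (x - t • v) v
  rw [integral_const_mul, ← hftc]
  ring

/-- Shearing: translating `g` along a segment against a fixed bounded function with compact support
is the same as translating that function backwards against `g`. -/
lemma integral_unitProd_shear {g : E → ℝ} (hg : LocallyIntegrable g μ) (hgm : Measurable g) (v : E)
    {ψ : E → ℝ} {K : Set E} {C : ℝ} (hK : IsCompact K) (hψ : Measurable ψ) (hC : ∀ x, |ψ x| ≤ C)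
    (h0 : ∀ x, x ∉ K → ψ x = 0) :
    Integrable (fun p : ℝ × E => g p.2 * ψ (p.2 - p.1 • v)) (unitProd μ) ∧
      Integrable (fun p : ℝ × E => g (p.2 + p.1 • v) * ψ p.2) (unitProd μ) ∧
      ∫ p : ℝ × E, g (p.2 + p.1 • v) * ψ p.2 ∂(unitProd μ) =
        ∫ p : ℝ × E, g p.2 * ψ (p.2 - p.1 • v) ∂(unitProd μ) := by
  have h1 : Integrable (fun p : ℝ × E => g p.2 * ψ (p.2 - p.1 • v)) (unitProd μ) := by
    refine integrable_unitProd hg hgm (isCompact_sweep hK v) (C := C)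
      (Ψ := fun p => ψ (p.2 - p.1 • v)) ?_ (fun p => hC _) ?_
    · exact hψ.comp (measurable_snd.sub (measurable_fst.smul_const v))
    · intro p hp hx
      exact h0 _ (notMem_of_notMem_sweep (Set.Ioc_subset_Icc_self hp) hx)
  have h2 := (measurePreserving_shear (μ := μ) v).integrable_comp_of_integrable h1
  have h3 := (measurePreserving_shear (μ := μ) v).integral_comp (measurableEmbedding_shear v)
    (fun p : ℝ × E => g p.2 * ψ (p.2 - p.1 • v))
  simp only [Function.comp_def, add_sub_cancel_right] at h2 h3
  exact ⟨h1, h2, h3⟩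

/-- A function with a weak derivative is, almost everywhere, the integral of that derivative along
short segments. -/
lemma ae_sub_eq_integral {U V : Set E} (hV : IsOpen V) {W g : E → ℝ} {v : E}
    (hW : LocallyIntegrable W μ) (hWm : Measurable W) (hg : LocallyIntegrable g μ)
    (hgm : Measurable g) (hwd : IsWeakDerivOn μ U W g v)
    (hUV : ∀ x ∈ V, ∀ t ∈ Set.Icc (0 : ℝ) 1, x + t • v ∈ U) :
    ∀ᵐ x ∂μ, x ∈ V → W (x + v) - W x = ∫ t in Set.Ioc (0 : ℝ) 1, g (x + t • v) := by
  have hloc : LocallyIntegrable (fun x => ∫ t in Set.Ioc (0 : ℝ) 1, g (x + t • v)) μ := by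
    rw [locallyIntegrable_iff]
    intro K hK
    have h := (integral_unitProd_shear hg hgm v (ψ := K.indicator 1) (C := 1) hK (measurable_one.indicator hK.measurableSet)
      (fun x => by by_cases hx : x ∈ K <;> simp [hx]) (fun x hx => by simp [hx])).2.1
    have h' := h.integral_prod_right
    rw [← integrable_indicator_iff hK.measurableSet]
    refine h'.congr (Eventually.of_forall fun x => ?_)
    by_cases hx : x ∈ K <;> simp [hx]
  have hWv : LocallyIntegrable (fun x => W (x + v)) μ := by
    rw [locallyIntegrable_iff]
    intro K hK
    have hK' : IsCompact ((fun x => x + v) '' K) := hK.image (by fun_prop)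
    have := (measurePreserving_add_right μ v).integrableOn_comp_preimage
      (Homeomorph.addRight v).measurableEmbedding (f := W) (s := (fun x => x + v) '' K)
    rw [Set.preimage_image_eq _ (add_left_injective v)] at this
    exact this.2 (hW.integrableOn_isCompact hK')
  have hA : LocallyIntegrable
      (fun x => W (x + v) - W x - ∫ t in Set.Ioc (0 : ℝ) 1, g (x + t • v)) μ :=
    (hWv.sub hW).sub hloc
  have hae := hV.ae_eq_zero_of_integral_contDiff_smul_eq_zero (μ := μ)
    (hA.locallyIntegrableOn V) ?_
  · filter_upwards [hae] with x hx hxV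
    exact sub_eq_zero.1 (hx hxV)
  intro φ hφ hc hsupp
  obtain ⟨C, hC⟩ := hc.exists_bound_of_continuous hφ.continuous
  obtain ⟨k1, k2, k3⟩ := integral_unitProd_shear hg hgm v (ψ := φ) (K := tsupport φ)
    (C := C) hc hφ.continuous.measurable (fun x => hC x)
    (fun x hx => image_eq_zero_of_notMem_tsupport hx)
  have i1 : Integrable (fun x => φ x * W (x + v)) μ := by
    simpa using hWv.integrable_smul_left_of_hasCompactSupport hφ.continuous hc
  have i2 : Integrable (fun x => φ x * W x) μ := by
    simpa using hW.integrable_smul_left_of_hasCompactSupport hφ.continuous hc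
  have i3 : Integrable (fun x => φ x * ∫ t in Set.Ioc (0 : ℝ) 1, g (x + t • v)) μ := by
    simpa using hloc.integrable_smul_left_of_hasCompactSupport hφ.continuous hc
  have e1 : ∫ x, φ x * W (x + v) ∂μ = ∫ x, φ (x - v) * W x ∂μ := by
    rw [← integral_add_right_eq_self (μ := μ) (fun x => φ (x - v) * W x) v]
    simp
  have i1' : Integrable (fun x => φ (x - v) * W x) μ := by
    have hc' : HasCompactSupport (fun x => φ (x - v)) :=
      hc.comp_homeomorph (Homeomorph.subRight v)
    simpa using hW.integrable_smul_left_of_hasCompactSupport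
      (hφ.continuous.comp (by fun_prop : Continuous fun x : E => x - v)) hc'
  have e3 : ∫ x, φ x * (∫ t in Set.Ioc (0 : ℝ) 1, g (x + t • v)) ∂μ =
      ∫ p : ℝ × E, g p.2 * φ (p.2 - p.1 • v) ∂(unitProd μ) := by
    rw [← k3, unitProd, integral_prod_symm _ k2]
    refine integral_congr_ae (Eventually.of_forall fun x => ?_)
    show _ = ∫ t in Set.Ioc (0 : ℝ) 1, g (x + t • v) * φ x
    rw [integral_mul_const, mul_comm]
  have e4 : ∫ p : ℝ × E, W p.2 * fderiv ℝ φ (p.2 - p.1 • v) v ∂(unitProd μ) =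
      -∫ p : ℝ × E, g p.2 * φ (p.2 - p.1 • v) ∂(unitProd μ) := by
    have hd : Continuous (fun x => fderiv ℝ φ x v) :=
      (hφ.continuous_fderiv (by simp)).clm_apply continuous_const
    have hdc : HasCompactSupport (fun x => fderiv ℝ φ x v) := hc.fderiv_apply ℝ v
    obtain ⟨C', hC'⟩ := hdc.exists_bound_of_continuous hd
    have hint : Integrable (fun p : ℝ × E => W p.2 * fderiv ℝ φ (p.2 - p.1 • v) v)
        (unitProd μ) := by
      refine integrable_unitProd hW hWm (isCompact_sweep hdc v) (C := C')
        (Ψ := fun p => fderiv ℝ φ (p.2 - p.1 • v) v) ?_ (fun p => hC' _) ?_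
      · exact (hd.comp (by fun_prop : Continuous fun p : ℝ × E => p.2 - p.1 • v)).measurable
      · intro p hp hx
        exact image_eq_zero_of_notMem_tsupport
          (f := fun x => fderiv ℝ φ x v)
          (notMem_of_notMem_sweep (Set.Ioc_subset_Icc_self hp) hx)
    rw [unitProd, integral_prod _ hint, integral_prod _ k1, ← integral_neg]
    refine setIntegral_congr_fun measurableSet_Ioc fun t ht => ?_
    have h := hwd (fun x => φ (x - t • v)) (hφ.comp (contDiff_id.sub contDiff_const))
      (hc.comp_homeomorph (Homeomorph.subRight (t • v))) (fun x hx => by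
        have := hUV _ (hsupp (tsupport_translate_subset _ hx)) t (Set.Ioc_subset_Icc_self ht)
        simpa using this)
    simpa [fderiv_comp_sub] using h
  have e5 := integral_mul_translate_sub hW hWm hφ hc v
  have e6 : ∫ x, W x * (φ (x - v) - φ x) ∂μ =
      ∫ x, φ (x - v) * W x ∂μ - ∫ x, φ x * W x ∂μ := by
    rw [← integral_sub i1' i2]
    congr 1; ext x; ring
  have e7 : ∀ x, φ x • (W (x + v) - W x - ∫ t in Set.Ioc (0 : ℝ) 1, g (x + t • v)) =
      φ x * W (x + v) - φ x * W x - φ x * ∫ t in Set.Ioc (0 : ℝ) 1, g (x + t • v) := by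
    intro x; simp only [smul_eq_mul]; ring
  simp only [e7]
  have i12 : Integrable (fun x => φ x * W (x + v) - φ x * W x) μ := i1.sub i2
  rw [integral_sub i12 i3, integral_sub i1 i2, e1, e3]
  linarith

/-- Hadamard's lemma: the difference quotient of a `C¹` function extends continuously to the
diagonal. -/
lemma exists_continuous_diffQuotient {η η' : ℝ → ℝ} (hη : ∀ y, HasDerivAt η (η' y) y)
    (hη' : Continuous η') : ∃ q : ℝ × ℝ → ℝ, Continuous q ∧ (∀ y, q (y, y) = η' y) ∧
      ∀ a b, η b - η a = q (a, b) * (b - a) := by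
  refine ⟨fun p => ∫ t in (0 : ℝ)..1, η' (p.1 + t * (p.2 - p.1)), ?_, ?_, ?_⟩
  · refine intervalIntegral.continuous_parametric_intervalIntegral_of_continuous'
      (f := fun (p : ℝ × ℝ) t => η' (p.1 + t * (p.2 - p.1))) ?_ 0 1
    exact hη'.comp (by fun_prop)
  · intro y
    simp
  · intro a b
    have h : ∀ t ∈ Set.uIcc (0 : ℝ) 1,
        HasDerivAt (fun t => η (a + t * (b - a))) (η' (a + t * (b - a)) * (b - a)) t := by
      intro t _
      have h1 : HasDerivAt (fun t : ℝ => a + t * (b - a)) (b - a) t := by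
        simpa using ((hasDerivAt_id t).mul_const (b - a)).const_add a
      exact (hη _).comp t h1
    have h2 := intervalIntegral.integral_eq_sub_of_hasDerivAt h
      ((by fun_prop : Continuous fun t => η' (a + t * (b - a)) * (b - a)).intervalIntegrable _ _)
    rw [intervalIntegral.integral_mul_const] at h2
    simpa using h2.symm

lemma locallyIntegrable_of_bounded {E : Type*} [NormedAddCommGroup E] [NormedSpace ℝ E]
    [FiniteDimensional ℝ E] [MeasurableSpace E] {μ : Measure E} [IsFiniteMeasureOnCompacts μ]
    {W : E → ℝ} (hWm : Measurable W) {C : ℝ} (hC : ∀ x, |W x| ≤ C) : LocallyIntegrable W μ := by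
  rw [locallyIntegrable_iff]
  intro K hK
  exact Measure.integrableOn_of_bounded hK.measure_lt_top.ne hWm.aestronglyMeasurable
    (Eventually.of_forall hC)

/-- Chain rule for weak derivatives of bounded functions that are continuous almost everywhere. Both
sides are limits of averaged difference quotients: the increment of `η ∘ W` is a difference quotient
of `η`, which converges boundedly almost everywhere, times the increment of `W`, which is an average
of translates of `g`. After moving the translations away from `g`, dominated convergence applies. -/
lemma IsWeakDerivOn.comp {U : Set E} (hU : IsOpen U) {W g : E → ℝ} {e : E} {C : ℝ}
    (hC : ∀ x, |W x| ≤ C) (hWm : Measurable W) (hWc : ∀ᵐ x ∂μ, x ∈ U → ContinuousAt W x)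
    (hg : LocallyIntegrable g μ) (hgm : Measurable g) (hwd : IsWeakDerivOn μ U W g e)
    {η η' : ℝ → ℝ} (hη : ∀ y, HasDerivAt η (η' y) y) (hη' : Continuous η') :
    IsWeakDerivOn μ U (fun x => η (W x)) (fun x => η' (W x) * g x) e := by
  intro φ hφ hc hsupp
  obtain ⟨q, hq, hqd, hqs⟩ := exists_continuous_diffQuotient hη hη'
  have hW : LocallyIntegrable W μ := locallyIntegrable_of_bounded hWm hC
  have hηc : Continuous η := continuous_iff_continuousAt.2 fun y => (hη y).continuousAt
  have hmem : ∀ x, W x ∈ Set.Icc (-C) C := fun x => abs_le.1 (hC x)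
  obtain ⟨M, hM⟩ := (isCompact_Icc (a := -C) (b := C)).exists_bound_of_continuousOn hηc.continuousOn
  obtain ⟨Q, hQ⟩ := ((isCompact_Icc (a := -C) (b := C)).prod
    (isCompact_Icc (a := -C) (b := C))).exists_bound_of_continuousOn hq.continuousOn
  obtain ⟨D, hD⟩ := hc.exists_bound_of_continuous hφ.continuous
  have hBm : Measurable (fun x => η (W x)) := hηc.measurable.comp hWm
  have hB : LocallyIntegrable (fun x => η (W x)) μ :=
    locallyIntegrable_of_bounded hBm (fun x => hM _ (hmem x))
  have hdc' : Continuous (fun x => fderiv ℝ φ x e) :=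
    (hφ.continuous_fderiv (by simp)).clm_apply continuous_const
  have hdcs : HasCompactSupport (fun x => fderiv ℝ φ x e) := hc.fderiv_apply ℝ e
  obtain ⟨D', hD'⟩ := hdcs.exists_bound_of_continuous hdc'
  obtain ⟨δ, hδ, hδU⟩ := hc.isCompact.exists_thickening_subset_open hU hsupp
  set K := tsupport φ with hK
  have hK1 : IsCompact (Metric.cthickening δ K) := hc.isCompact.cthickening
  -- step sizes for which the translated supports stay inside `U`
  obtain ⟨r, hr0, hrδ, hrlim⟩ : ∃ r : ℕ → ℝ, (∀ n, 0 < r n) ∧ (∀ n, ‖r n • e‖ < δ / 2) ∧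
      Tendsto r atTop (𝓝 0) := by
    have he : 0 < ‖e‖ + 1 := by positivity
    refine ⟨fun n => δ / 2 / (‖e‖ + 1) * (1 / ((n : ℝ) + 1)), fun n => by positivity,
      fun n => ?_, ?_⟩
    · have h1 : 1 / ((n : ℝ) + 1) ≤ 1 := by
        rw [div_le_one (by positivity)]; linarith [(Nat.cast_nonneg n : (0 : ℝ) ≤ n)]
      rw [norm_smul, Real.norm_of_nonneg (by positivity)]
      calc δ / 2 / (‖e‖ + 1) * (1 / ((n : ℝ) + 1)) * ‖e‖
          ≤ δ / 2 / (‖e‖ + 1) * 1 * ‖e‖ := by gcongr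
        _ < δ / 2 / (‖e‖ + 1) * 1 * (‖e‖ + 1) := by gcongr; linarith
        _ = δ / 2 := by field_simp
    · simpa using tendsto_one_div_add_atTop_nhds_zero_nat.const_mul (δ / 2 / (‖e‖ + 1))
  have hsmall : ∀ n, ∀ t ∈ Set.Icc (0 : ℝ) 1, ‖t • r n • e‖ < δ / 2 := by
    intro n t ht
    rw [norm_smul, Real.norm_of_nonneg ht.1]
    exact (mul_le_of_le_one_left (norm_nonneg _) ht.2).trans_lt (hrδ n)
  have hnotK : ∀ n, ∀ t ∈ Set.Icc (0 : ℝ) 1, ∀ x, x ∉ Metric.cthickening δ K →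
      x - t • r n • e ∉ K := by
    intro n t ht x hx hxK
    refine hx (Metric.mem_cthickening_of_dist_le x _ δ K hxK ?_)
    rw [dist_eq_norm, sub_sub_cancel]
    linarith [hsmall n t ht]
  have htend : ∀ (x : E) (t : ℝ), Tendsto (fun n => x - t • r n • e) atTop (𝓝 x) := by
    intro x t
    simpa using tendsto_const_nhds.sub ((hrlim.smul_const e).const_smul t)
  have htend' : ∀ (x : E) (t : ℝ), Tendsto (fun n => x - t • r n • e + r n • e) atTop (𝓝 x) := by
    intro x t
    simpa using (htend x t).add (hrlim.smul_const e)
  -- the bounded factor in front of the averaged translates of `g`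
  let ψ : ℕ → E → ℝ := fun n x => q (W x, W (x + r n • e)) * φ x
  have hψm : ∀ n, Measurable (ψ n) := fun n =>
    (hq.measurable.comp (hWm.prodMk (hWm.comp (measurable_add_const _)))).mul
      hφ.continuous.measurable
  have hψC : ∀ n x, |ψ n x| ≤ Q * D := by
    intro n x
    rw [abs_mul]
    have h1 : |q (W x, W (x + r n • e))| ≤ Q := hQ _ ⟨hmem _, hmem _⟩
    exact mul_le_mul h1 (hD x) (abs_nonneg _) ((abs_nonneg _).trans h1)
  have hψ0 : ∀ n x, x ∉ K → ψ n x = 0 := fun n x hx => by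
    simp [ψ, image_eq_zero_of_notMem_tsupport hx]
  have lim1 : Tendsto (fun n => ∫ p : ℝ × E, η (W p.2) * fderiv ℝ φ (p.2 - p.1 • r n • e) e
      ∂(unitProd μ)) atTop (𝓝 (∫ x, η (W x) * fderiv ℝ φ x e ∂μ)) := by
    refine tendsto_integral_unitProd hB hBm hK1 (C := D')
      (Ψ := fun n p => fderiv ℝ φ (p.2 - p.1 • r n • e) e) (fun n => ?_) (fun n p => hD' _)
      (fun n p hp hx => ?_) (Eventually.of_forall fun x t => ?_)
    · exact (hdc'.comp (by fun_prop : Continuous fun p : ℝ × E => p.2 - p.1 • r n • e)).measurable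
    · have h1 := hnotK n p.1 (Set.Ioc_subset_Icc_self hp) _ hx
      exact image_eq_zero_of_notMem_tsupport (f := fun x => fderiv ℝ φ x e)
        (fun h => h1 (tsupport_fderiv_apply_subset ℝ e h))
    · exact (hdc'.tendsto x).comp (htend x t)
  have lim2 : Tendsto (fun n => ∫ p : ℝ × E, g p.2 * ψ n (p.2 - p.1 • r n • e)
      ∂(unitProd μ)) atTop (𝓝 (∫ x, g x * (η' (W x) * φ x) ∂μ)) := by
    refine tendsto_integral_unitProd hg hgm hK1 (C := Q * D)
      (Ψ := fun n p => ψ n (p.2 - p.1 • r n • e)) (fun n => ?_) (fun n p => hψC n _)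
      (fun n p hp hx => hψ0 n _ (hnotK n p.1 (Set.Ioc_subset_Icc_self hp) _ hx)) ?_
    · exact (hψm n).comp (measurable_snd.sub (measurable_fst.smul_const _))
    · filter_upwards [hWc] with x hx t
      by_cases hxK : x ∈ K
      · have hWx := hx (hsupp hxK)
        rw [← hqd]
        refine Tendsto.mul ?_ ((hφ.continuous.tendsto x).comp (htend x t))
        refine (hq.tendsto _).comp ?_
        exact (hWx.tendsto.comp (htend x t)).prodMk_nhds (hWx.tendsto.comp (htend' x t))
      · rw [image_eq_zero_of_notMem_tsupport hxK, mul_zero]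
        refine tendsto_const_nhds.congr' ?_
        have hopen : Kᶜ ∈ 𝓝 x := (isClosed_tsupport φ).isOpen_compl.mem_nhds hxK
        filter_upwards [(htend x t).eventually hopen] with n hn
        exact (hψ0 n _ hn).symm
  -- before the limit: the discrete product formula for the increment of `η ∘ W`, divided by `r n`
  have hstep : ∀ n, ∫ p : ℝ × E, g p.2 * ψ n (p.2 - p.1 • r n • e) ∂(unitProd μ) =
      -∫ p : ℝ × E, η (W p.2) * fderiv ℝ φ (p.2 - p.1 • r n • e) e ∂(unitProd μ) := by
    intro n
    set v := r n • e with hv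
    have hwdv : IsWeakDerivOn μ U W (fun x => r n * g x) v := by
      intro χ h1 h2 h3
      have := hwd χ h1 h2 h3
      simp only [hv, map_smul, smul_eq_mul, mul_assoc, integral_const_mul, ← mul_neg, ← this,
        mul_left_comm (W _)]
    have hae := ae_sub_eq_integral (μ := μ) (U := U) (V := Metric.thickening (δ / 2) K)
      Metric.isOpen_thickening hW hWm (hg.smul (r n)) (hgm.const_mul _) hwdv (fun x hx t ht => by
        obtain ⟨y, hy, hxy⟩ := Metric.mem_thickening_iff.1 hx
        refine hδU (Metric.mem_thickening_iff.2 ⟨y, hy, ?_⟩)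
        have h1 := hsmall n t ht
        have h2 : dist (x + t • v) x < δ / 2 := by simpa [dist_eq_norm] using h1
        linarith [dist_triangle (x + t • v) x y])
    obtain ⟨-, k2, k3⟩ := integral_unitProd_shear hg hgm v hc.isCompact (hψm n) (hψC n) (hψ0 n)
    have hT : ∫ x, η (W x) * (φ (x - v) - φ x) ∂μ = ∫ x, (η (W (x + v)) - η (W x)) * φ x ∂μ := by
      have i1 : Integrable (fun x => η (W x) * φ x) μ := by
        simpa [mul_comm] using hB.integrable_smul_left_of_hasCompactSupport hφ.continuous hc
      have i2 : Integrable (fun x => η (W x) * φ (x - v)) μ := by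
        simpa [mul_comm] using hB.integrable_smul_left_of_hasCompactSupport
          (hφ.continuous.comp (by fun_prop : Continuous fun x : E => x - v))
          (hc.comp_homeomorph (Homeomorph.subRight v))
      have i3 : Integrable (fun x => η (W (x + v)) * φ x) μ := by
        simpa using i2.comp_add_right v
      have e1 : ∫ x, η (W (x + v)) * φ x ∂μ = ∫ x, η (W x) * φ (x - v) ∂μ := by
        rw [← integral_add_right_eq_self (μ := μ) (fun x => η (W x) * φ (x - v)) v]
        simp
      simp only [mul_sub, sub_mul]
      rw [integral_sub i2 i1, integral_sub i3 i1, e1]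
    have hT2 : ∫ x, (η (W (x + v)) - η (W x)) * φ x ∂μ =
        r n * ∫ p : ℝ × E, g (p.2 + p.1 • v) * ψ n p.2 ∂(unitProd μ) := by
      rw [unitProd, integral_prod_symm _ k2, ← integral_const_mul]
      refine integral_congr_ae ?_
      filter_upwards [hae] with x hx
      show _ = r n * ∫ t in Set.Ioc (0 : ℝ) 1, g (x + t • v) * ψ n x
      rw [integral_mul_const]
      by_cases hxK : x ∈ K
      · have h1 := hx (Metric.self_subset_thickening (by positivity) K hxK)
        simp only [Pi.smul_apply, smul_eq_mul] at h1
        rw [integral_const_mul] at h1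
        rw [hqs, h1]
        simp only [ψ, ← hv]
        ring
      · rw [hψ0 n x hxK, image_eq_zero_of_notMem_tsupport hxK]
        simp
    have hT3 := integral_mul_translate_sub hB hBm hφ hc v
    rw [hT, hT2, k3] at hT3
    have hT4 : ∀ p : ℝ × E, η (W p.2) * fderiv ℝ φ (p.2 - p.1 • v) v =
        r n * (η (W p.2) * fderiv ℝ φ (p.2 - p.1 • v) e) := by
      intro p
      rw [hv, map_smul, smul_eq_mul]
      ring
    simp only [hT4] at hT3
    rw [integral_const_mul, ← mul_neg] at hT3
    exact mul_left_cancel₀ (hr0 n).ne' hT3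
  have hfin := tendsto_nhds_unique (lim2.congr hstep) lim1.neg
  rw [← neg_eq_iff_eq_neg] at hfin
  rw [← hfin]
  congr 2
  ext x
  ring

end ChainRule

/-! ### Periodic functions and periodization -/

section Periodization

open Filter Topology

variable {d : ℕ} {a b : Fin d → ℝ}

/-- The period vector with integer coordinates `k` of the lattice `∏ (bᵢ - aᵢ) ℤ`. -/
noncomputable def period (a b : Fin d → ℝ) (k : Fin d → ℤ) : Pt d :=
  WithLp.toLp 2 fun i => (k i : ℝ) * (b i - a i)

/-- The half-open box `∏ [aᵢ, bᵢ)`, a fundamental domain of the lattice of periods. -/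
def cell (a b : Fin d → ℝ) : Set (Pt d) := {x | ∀ i, a i ≤ x i ∧ x i < b i}

/-- The index of the translate of `cell a b` that contains a point. -/
noncomputable def cellIdx (a b : Fin d → ℝ) (x : Pt d) : Fin d → ℤ :=
  fun i => ⌊(x i - a i) / (b i - a i)⌋

/-- The representative of a point in `cell a b`, modulo periods. -/
noncomputable def fold (a b : Fin d → ℝ) (x : Pt d) : Pt d := x - period a b (cellIdx a b x)

/-- The sum of all translates of a function by periods. -/
noncomputable def periodize (a b : Fin d → ℝ) (φ : Pt d → ℝ) (x : Pt d) : ℝ :=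
  ∑' k : Fin d → ℤ, φ (x + period a b k)

@[simp] lemma period_apply (k : Fin d → ℤ) (i : Fin d) :
    period a b k i = (k i : ℝ) * (b i - a i) := rfl

lemma period_add (k l : Fin d → ℤ) : period a b (k + l) = period a b k + period a b l := by
  ext i; simp [add_mul]

@[simp] lemma period_zero : period a b 0 = 0 := by ext i; simp

lemma period_neg (k : Fin d → ℤ) : period a b (-k) = -period a b k := by
  ext i; simp

lemma period_eq_sum (k : Fin d → ℤ) :
    period a b k = ∑ i, k i • ((b i - a i) • coordVec i : Pt d) := by
  ext j
  rw [WithLp.ofLp_sum, Finset.sum_apply]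
  simp [coordVec]

lemma cellIdx_add_period (hab : ∀ i, a i < b i) (x : Pt d) (k : Fin d → ℤ) :
    cellIdx a b (x + period a b k) = cellIdx a b x + k := by
  ext i
  have h : b i - a i ≠ 0 := (sub_pos.2 (hab i)).ne'
  simp only [cellIdx, PiLp.add_apply, period_apply, Pi.add_apply]
  rw [← Int.floor_add_intCast]
  congr 1
  field_simp
  ring

lemma mem_cell_iff (hab : ∀ i, a i < b i) (x : Pt d) : x ∈ cell a b ↔ cellIdx a b x = 0 := by
  simp only [cell, Set.mem_ofPred_eq, funext_iff, cellIdx, Int.floor_eq_zero_iff, Set.mem_Ico,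
    Pi.zero_apply]
  refine forall_congr' fun i => ?_
  have h : 0 < b i - a i := sub_pos.2 (hab i)
  rw [le_div_iff₀ h, div_lt_iff₀ h]
  constructor <;> rintro ⟨h1, h2⟩ <;> constructor <;> linarith

lemma fold_add_period (hab : ∀ i, a i < b i) (x : Pt d) (k : Fin d → ℤ) :
    fold a b (x + period a b k) = fold a b x := by
  rw [fold, fold, cellIdx_add_period hab, period_add]
  abel

lemma fold_of_mem_cell (hab : ∀ i, a i < b i) {x : Pt d} (hx : x ∈ cell a b) :
    fold a b x = x := by
  rw [fold, (mem_cell_iff hab x).1 hx]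
  simp

lemma fold_mem_cell (hab : ∀ i, a i < b i) (x : Pt d) : fold a b x ∈ cell a b := by
  rw [mem_cell_iff hab, fold, sub_eq_add_neg, ← period_neg, cellIdx_add_period hab]
  simp

lemma fold_eq_add_period (x : Pt d) : fold a b x = x + period a b (-cellIdx a b x) := by
  rw [period_neg, fold, sub_eq_add_neg]

lemma measurable_coord (i : Fin d) : Measurable (fun x : Pt d => x i) :=
  (by fun_prop : Continuous fun x : Pt d => x i).measurable

lemma measurable_cellIdx : Measurable (cellIdx a b) :=
  measurable_pi_lambda _ fun i => (((measurable_coord i).sub_const _).div_const _).floor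

lemma measurable_fold : Measurable (fold a b) :=
  measurable_id.sub ((measurable_of_countable (period a b)).comp measurable_cellIdx)

lemma measurableSet_cell : MeasurableSet (cell a b) := by
  have : cell a b = ⋂ i, {x : Pt d | a i ≤ x i ∧ x i < b i} := by ext; simp [cell]
  rw [this]
  exact MeasurableSet.iInter fun i =>
    (measurableSet_le measurable_const (measurable_coord i)).inter
      (measurableSet_lt (measurable_coord i) measurable_const)

lemma measurableSet_cellIdx_eq (k : Fin d → ℤ) : MeasurableSet {x : Pt d | cellIdx a b x = k} :=
  measurable_cellIdx (measurableSet_singleton k)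

lemma preimage_add_period (hab : ∀ i, a i < b i) (k : Fin d → ℤ) :
    (fun x : Pt d => x + period a b k) ⁻¹' {x | cellIdx a b x = k} = cell a b := by
  ext x
  rw [Set.mem_preimage, Set.mem_ofPred_eq, cellIdx_add_period hab, mem_cell_iff hab]
  simp

lemma abs_coord_le_norm (x : Pt d) (i : Fin d) : |x i| ≤ ‖x‖ := by
  simpa using PiLp.norm_apply_le x i

/-- A bounded set meets only finitely many translates of the cell. -/
lemma finite_cellIdx_image (hab : ∀ i, a i < b i) {K : Set (Pt d)} (hK : Bornology.IsBounded K) :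
    (cellIdx a b '' K).Finite := by
  obtain ⟨R, hR⟩ := hK.exists_norm_le
  refine (Set.finite_Icc (fun i => ⌊(-R - a i) / (b i - a i)⌋)
    (fun i => ⌊(R - a i) / (b i - a i)⌋)).subset ?_
  rintro _ ⟨x, hx, rfl⟩
  have h := fun i => abs_le.1 ((abs_coord_le_norm x i).trans (hR x hx))
  have h' := fun i => (sub_pos.2 (hab i)).le
  exact ⟨fun i => Int.floor_mono (div_le_div_of_nonneg_right (by linarith [(h i).1]) (h' i)),
    fun i => Int.floor_mono (div_le_div_of_nonneg_right (by linarith [(h i).2]) (h' i))⟩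

lemma exists_finset_period (hab : ∀ i, a i < b i) {K B : Set (Pt d)}
    (hK : Bornology.IsBounded K) (hB : Bornology.IsBounded B) :
    ∃ S : Finset (Fin d → ℤ), ∀ x ∈ B, ∀ k, x + period a b k ∈ K → k ∈ S := by
  classical
  have hf := (finite_cellIdx_image hab hK).sub (finite_cellIdx_image hab hB)
  refine ⟨hf.toFinset, fun x hx k hk => hf.mem_toFinset.2 ?_⟩
  refine ⟨_, ⟨_, hk, rfl⟩, _, ⟨_, hx, rfl⟩, ?_⟩
  simp [cellIdx_add_period hab]

lemma isBounded_cell : Bornology.IsBounded (cell a b) := by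
  have h : Bornology.IsBounded (Set.univ.pi fun i => Set.Icc (a i) (b i)) :=
    Bornology.IsBounded.pi fun i => Metric.isBounded_Icc _ _
  have h2 := (PiLp.antilipschitzWith_ofLp 2 (fun _ : Fin d => ℝ)).isBounded_preimage h
  refine h2.subset fun x hx => ?_
  simp only [Set.mem_preimage, Set.mem_univ_pi]
  exact fun i => ⟨(hx i).1, (hx i).2.le⟩

lemma exists_finset_periodize (hab : ∀ i, a i < b i) {φ : Pt d → ℝ} (hc : HasCompactSupport φ)
    {B : Set (Pt d)} (hB : Bornology.IsBounded B) :
    ∃ S : Finset (Fin d → ℤ), (∀ x ∈ B, ∀ k ∉ S, φ (x + period a b k) = 0) ∧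
      ∀ x ∈ B, periodize a b φ x = ∑ k ∈ S, φ (x + period a b k) := by
  obtain ⟨S, hS⟩ := exists_finset_period hab hc.isCompact.isBounded hB
  have h0 : ∀ x ∈ B, ∀ k ∉ S, φ (x + period a b k) = 0 := fun x hx k hk =>
    image_eq_zero_of_notMem_tsupport fun h => hk (hS x hx k h)
  exact ⟨S, h0, fun x hx => tsum_eq_sum fun k hk => h0 x hx k hk⟩

lemma periodize_add_period (φ : Pt d → ℝ) (x : Pt d) (k : Fin d → ℤ) :
    periodize a b φ (x + period a b k) = periodize a b φ x := by
  refine (tsum_congr fun l => ?_).trans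
    ((Equiv.addLeft k).tsum_eq fun l => φ (x + period a b l))
  simp [period_add, add_assoc]

lemma eventuallyEq_periodize (hab : ∀ i, a i < b i) {φ : Pt d → ℝ} (hc : HasCompactSupport φ)
    (x : Pt d) : ∃ S : Finset (Fin d → ℤ),
      (∀ k ∉ S, (fun y => φ (y + period a b k)) =ᶠ[𝓝 x] fun _ => 0) ∧
      periodize a b φ =ᶠ[𝓝 x] fun y => ∑ k ∈ S, φ (y + period a b k) := by
  obtain ⟨S, h0, h1⟩ := exists_finset_periodize hab hc (Metric.isBounded_ball (x := x) (r := 1))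
  have hball := Metric.ball_mem_nhds x one_pos
  refine ⟨S, fun k hk => ?_, ?_⟩
  · filter_upwards [hball] with y hy using h0 y hy k hk
  · filter_upwards [hball] with y hy using h1 y hy

lemma contDiff_periodize (hab : ∀ i, a i < b i) {φ : Pt d → ℝ} (hφ : ContDiff ℝ ∞ φ)
    (hc : HasCompactSupport φ) : ContDiff ℝ ∞ (periodize a b φ) := by
  refine contDiff_iff_contDiffAt.2 fun x => ?_
  obtain ⟨S, -, hS⟩ := eventuallyEq_periodize hab hc x
  refine ContDiffAt.congr_of_eventuallyEq ?_ hS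
  exact (ContDiff.sum fun k _ => hφ.comp (contDiff_id.add contDiff_const)).contDiffAt

lemma fderiv_periodize (hab : ∀ i, a i < b i) {φ : Pt d → ℝ} (hφ : ContDiff ℝ ∞ φ)
    (hc : HasCompactSupport φ) (e x : Pt d) :
    fderiv ℝ (periodize a b φ) x e = periodize a b (fun y => fderiv ℝ φ y e) x := by
  obtain ⟨S, h0, h1⟩ := eventuallyEq_periodize hab hc x
  have hd : Differentiable ℝ φ := hφ.differentiable (by simp)
  have hd' : ∀ k ∈ S, DifferentiableAt ℝ (fun y => φ (y + period a b k)) x := fun k _ =>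
    (hd.comp (differentiable_id.add_const (period a b k))) x
  rw [h1.fderiv_eq, fderiv_fun_sum hd', periodize, tsum_eq_sum (s := S)]
  · simp [fderiv_comp_add_right]
  · intro k hk
    rw [← fderiv_comp_add_right, (h0 k hk).fderiv_eq]
    simp

/-- Unfolding: integrating a periodic function against `ψ` over the whole space amounts to
integrating it against the periodization of `ψ` over one cell. -/
lemma integral_mul_eq_setIntegral_periodize (hab : ∀ i, a i < b i) {F ψ : Pt d → ℝ}
    (hF : LocallyIntegrable F) (hper : ∀ x k, F (x + period a b k) = F x) (hψ : Continuous ψ)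
    (hc : HasCompactSupport ψ) :
    ∫ x, F x * ψ x = ∫ x in cell a b, F x * periodize a b ψ x := by
  obtain ⟨S, h0, h1⟩ := exists_finset_periodize hab hc (isBounded_cell (a := a) (b := b))
  have hi : Integrable (fun x => F x * ψ x) := by
    simpa [mul_comm] using hF.integrable_smul_left_of_hasCompactSupport hψ hc
  have hsupp : ∀ x, cellIdx a b x ∉ S → ψ x = 0 := by
    intro x hx
    have h := h0 _ (fold_mem_cell hab x) _ hx
    simpa [fold] using h
  have e1 : ∫ x, F x * ψ x = ∫ x in ⋃ k ∈ S, {x | cellIdx a b x = k}, F x * ψ x := by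
    refine (setIntegral_eq_integral_of_forall_compl_eq_zero fun x hx => ?_).symm
    rw [hsupp x (fun h => hx (by simpa using h)), mul_zero]
  have e2 : ∀ k, ∫ x in {x | cellIdx a b x = k}, F x * ψ x =
      ∫ x in cell a b, F x * ψ (x + period a b k) := by
    intro k
    rw [← preimage_add_period hab k, ← (measurePreserving_add_right volume
      (period a b k)).setIntegral_preimage_emb
      (Homeomorph.addRight (period a b k)).measurableEmbedding]
    simp only [hper]
  rw [e1, integral_biUnion_finset _ (fun k _ => measurableSet_cellIdx_eq k) (fun k _ l _ hkl =>
    Set.disjoint_left.2 fun x hx hx' => hkl (hx.symm.trans hx')) (fun k _ => hi.integrableOn)]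
  simp only [e2]
  rw [← integral_finsetSum]
  · refine setIntegral_congr_fun measurableSet_cell fun x hx => ?_
    simp only [h1 x hx, Finset.mul_sum]
  · intro k _
    have := hi.comp_add_right (period a b k)
    simp only [hper] at this
    exact this.integrableOn

/-- Every smooth periodic function is the periodization of a smooth function with compact support:
multiply it by a cut-off function `χ₀ / ∑ₖ χ₀ (· + k)`. -/
lemma exists_periodize_eq (hab : ∀ i, a i < b i) {φ : Pt d → ℝ} (hφ : ContDiff ℝ ∞ φ)
    (hper : ∀ x k, φ (x + period a b k) = φ x) :
    ∃ ψ : Pt d → ℝ, ContDiff ℝ ∞ ψ ∧ HasCompactSupport ψ ∧ periodize a b ψ = φ := by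
  obtain ⟨R, hR0, hR⟩ := (isBounded_cell (a := a) (b := b)).exists_pos_norm_le
  let χ : ContDiffBump (0 : Pt d) := ⟨R, R + 1, hR0, by linarith⟩
  have hχ : ContDiff ℝ ∞ χ := χ.contDiff
  have hpos : ∀ x, 0 < periodize a b χ x := by
    intro x
    obtain ⟨S, h0, -⟩ := exists_finset_periodize hab χ.hasCompactSupport
      (Bornology.isBounded_singleton (x := x))
    have hs : Summable fun k => χ (x + period a b k) :=
      summable_of_ne_finset_zero (s := S) fun k hk => h0 x rfl k hk
    have h1 : χ (x + period a b (-cellIdx a b x)) = 1 := by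
      refine χ.one_of_mem_closedBall ?_
      rw [← fold_eq_add_period, mem_closedBall_zero_iff]
      exact hR _ (fold_mem_cell hab x)
    have h2 := hs.le_tsum (-cellIdx a b x) fun k _ => χ.nonneg
    rw [h1] at h2
    exact one_pos.trans_le h2
  refine ⟨fun x => χ x * (φ x / periodize a b χ x), ?_, χ.hasCompactSupport.mul_right, ?_⟩
  · exact hχ.mul (hφ.div (contDiff_periodize hab hχ χ.hasCompactSupport) fun x => (hpos x).ne')
  · ext x
    have : ∀ k, χ (x + period a b k) * (φ (x + period a b k) /
        periodize a b χ (x + period a b k)) =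
        χ (x + period a b k) * (φ x / periodize a b χ x) := fun k => by
      rw [hper, periodize_add_period]
    rw [periodize, tsum_congr this, tsum_mul_right]
    exact mul_div_cancel₀ _ (hpos x).ne'

lemma locallyIntegrable_comp_fold (hab : ∀ i, a i < b i) {g : Pt d → ℝ}
    (hg : IntegrableOn g (cell a b)) : LocallyIntegrable (fun x => g (fold a b x)) := by
  rw [locallyIntegrable_iff]
  intro K hK
  have hf := finite_cellIdx_image (a := a) (b := b) hab hK.isBounded
  have h1 : ∀ k, IntegrableOn (fun x => g (fold a b x)) {x | cellIdx a b x = k} := by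
    intro k
    rw [← (measurePreserving_add_right volume (period a b k)).integrableOn_comp_preimage
      (Homeomorph.addRight (period a b k)).measurableEmbedding, preimage_add_period hab]
    refine hg.congr_fun (fun x hx => ?_) measurableSet_cell
    simp [fold_add_period hab, fold_of_mem_cell hab hx]
  have h2 : IntegrableOn (fun x => g (fold a b x)) (⋃ k ∈ hf.toFinset, {x | cellIdx a b x = k}) :=
    integrableOn_finset_iUnion.2 fun k _ => h1 k
  refine h2.mono_set fun x hx => ?_
  simp only [Set.mem_iUnion]
  exact ⟨cellIdx a b x, hf.mem_toFinset.2 ⟨x, hx, rfl⟩, rfl⟩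

/-- The open box differs from the cell by a null set. -/
lemma dom_ae_eq_cell : (BVSetting.periodic a b).dom =ᵐ[volume] cell a b := by
  have h : (Set.univ.pi fun i => Set.Ioo (a i) (b i)) =ᵐ[volume]
      (Set.univ.pi fun i => Set.Ico (a i) (b i)) :=
    (Measure.univ_pi_Ioo_ae_eq_Icc (μ := fun _ : Fin d => volume)).trans
      (Measure.univ_pi_Ico_ae_eq_Icc (μ := fun _ : Fin d => volume)).symm
  have h2 := (PiLp.volume_preserving_ofLp (Fin d)).quasiMeasurePreserving.preimage_ae_eq h
  have e1 : (BVSetting.periodic a b).dom =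
      WithLp.ofLp ⁻¹' (Set.univ.pi fun i => Set.Ioo (a i) (b i)) := by
    ext x; simp [BVSetting.dom]
  have e2 : cell a b = WithLp.ofLp ⁻¹' (Set.univ.pi fun i => Set.Ico (a i) (b i)) := by
    ext x; simp [cell]
  rw [e1, e2]
  exact h2

lemma dom_subset_cell : (BVSetting.periodic a b).dom ⊆ cell a b := fun _ hx i =>
  ⟨(hx i).1.le, (hx i).2⟩

lemma ae_fold_mem_dom (hab : ∀ i, a i < b i) :
    ∀ᵐ x, fold a b x ∈ (BVSetting.periodic a b).dom := by
  have h0 : ∀ᵐ x : Pt d, x ∈ cell a b → x ∈ (BVSetting.periodic a b).dom := by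
    filter_upwards [dom_ae_eq_cell (a := a) (b := b)] with x hx h
    exact (eq_iff_iff.1 hx).2 h
  have h1 : ∀ᵐ x : Pt d, ∀ k : Fin d → ℤ, x + period a b k ∈ cell a b →
      x + period a b k ∈ (BVSetting.periodic a b).dom :=
    ae_all_iff.2 fun k =>
      (measurePreserving_add_right volume (period a b k)).quasiMeasurePreserving.ae h0
  filter_upwards [h1] with x hx
  rw [fold_eq_add_period]
  refine hx _ ?_
  rw [← fold_eq_add_period]
  exact fold_mem_cell hab x

lemma isOpen_dom_periodic : IsOpen (BVSetting.periodic a b).dom := by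
  have : (BVSetting.periodic a b).dom = ⋂ i, {x : Pt d | a i < x i ∧ x i < b i} := by
    ext; simp [BVSetting.dom]
  rw [this]
  refine isOpen_iInter_of_finite fun i => ?_
  have hc : Continuous fun x : Pt d => x i := by fun_prop
  exact (isOpen_lt continuous_const hc).inter (isOpen_lt hc continuous_const)

lemma continuousAt_fold (hab : ∀ i, a i < b i) {x : Pt d}
    (hx : fold a b x ∈ (BVSetting.periodic a b).dom) : ContinuousAt (fold a b) x := by
  have hc : Continuous fun y : Pt d => y - period a b (cellIdx a b x) := by fun_prop
  have hev : (fun y : Pt d => y - period a b (cellIdx a b x)) =ᶠ[𝓝 x] fold a b := by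
    filter_upwards [hc.continuousAt.eventually (isOpen_dom_periodic.mem_nhds hx)] with y hy
    have h1 := fold_of_mem_cell hab (dom_subset_cell hy)
    rw [← h1, sub_eq_add_neg, ← period_neg, fold_add_period hab]
  exact hc.continuousAt.congr hev

end Periodization
/-! ### The space `H¹` with boundary condition, and testing the Laplacian -/

namespace BVSetting

open Filter Topology

variable {d : ℕ} {S : BVSetting d}

lemma isOpen_dom (hS : S.IsAdmissible) : IsOpen S.dom := by
  cases S with
  | periodic a b => exact isOpen_dom_periodic
  | neumann Ω => exact hS.1

lemma isBounded_dom (hS : S.IsAdmissible) : Bornology.IsBounded S.dom := by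
  cases S with
  | periodic a b => exact isBounded_cell.subset dom_subset_cell
  | neumann Ω => exact hS.2.2

lemma isConnected_dom (hS : S.IsAdmissible) : IsConnected S.dom := by
  cases S with
  | periodic a b =>
    refine ⟨⟨WithLp.toLp 2 fun i => (a i + b i) / 2, fun i => ?_⟩, ?_⟩
    · have h : a i < b i := hS i
      show a i < (a i + b i) / 2 ∧ (a i + b i) / 2 < b i
      constructor <;> linarith
    · refine Convex.isPreconnected fun x hx y hy s t hs ht hst i => ?_
      have h : (s • x + t • y) i ∈ Set.Ioo (a i) (b i) :=
        convex_Ioo (a i) (b i) (hx i) (hy i) hs ht hst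
      exact h
  | neumann Ω => exact hS.2.1

lemma measurableSet_dom (hS : S.IsAdmissible) : MeasurableSet S.dom :=
  (isOpen_dom hS).measurableSet

lemma isCompact_closure_dom (hS : S.IsAdmissible) : IsCompact (closure S.dom) :=
  (isBounded_dom hS).isCompact_closure

lemma volume_dom_lt_top (hS : S.IsAdmissible) : volume S.dom < ⊤ :=
  (isBounded_dom hS).measure_lt_top

lemma isFiniteMeasure_restrict_dom (hS : S.IsAdmissible) :
    IsFiniteMeasure (volume.restrict S.dom) :=
  ⟨by simpa using volume_dom_lt_top hS⟩

lemma IsTest.contDiff {φ : Pt d → ℝ} (h : S.IsTest φ) : ContDiff ℝ ∞ φ := by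
  cases S with
  | periodic a b => exact h.1
  | neumann Ω => exact h.1

lemma add_period_eq_of_isTest {a b : Fin d → ℝ} {φ : Pt d → ℝ} (h : (periodic a b).IsTest φ)
    (x : Pt d) (k : Fin d → ℤ) : φ (x + period a b k) = φ x := by
  have h1 : ∀ i, Function.Periodic φ ((b i - a i) • coordVec i) := fun i y => h.2 i y
  have h2 : ∀ s : Finset (Fin d), Function.Periodic φ
      (∑ i ∈ s, k i • ((b i - a i) • coordVec i : Pt d)) := by
    intro s
    classical
    induction s using Finset.induction_on with
    | empty => intro y; simp
    | insert i s hi ih =>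
      rw [Finset.sum_insert hi]
      exact ((h1 i).zsmul (k i)).add_period ih
  rw [period_eq_sum]
  exact h2 _ x

lemma isTest_periodize {a b : Fin d → ℝ} (hab : ∀ i, a i < b i) {φ : Pt d → ℝ}
    (hφ : ContDiff ℝ ∞ φ) (hc : HasCompactSupport φ) :
    (periodic a b).IsTest (periodize a b φ) := by
  classical
  refine ⟨contDiff_periodize hab hφ hc, fun i x => ?_⟩
  have h := periodize_add_period (a := a) (b := b) φ x (Pi.single i 1)
  convert h using 3
  ext j
  by_cases hj : j = i
  · subst hj; simp [coordVec]
  · simp [coordVec, hj]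

/-- Unfolding, for the integral over the open box of a function without periodicity. -/
lemma integral_fold_mul {a b : Fin d → ℝ} (hab : ∀ i, a i < b i) {g ψ : Pt d → ℝ}
    (hg : IntegrableOn g (cell a b)) (hψ : Continuous ψ) (hc : HasCompactSupport ψ) :
    ∫ x, g (fold a b x) * ψ x = ∫ x in (periodic a b).dom, g x * periodize a b ψ x := by
  rw [integral_mul_eq_setIntegral_periodize hab (locallyIntegrable_comp_fold hab hg)
    (fun x k => by rw [fold_add_period hab]) hψ hc, setIntegral_congr_set dom_ae_eq_cell]
  exact setIntegral_congr_fun measurableSet_cell fun x hx => by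
    simp only [fold_of_mem_cell hab hx]

/-- Being a weak derivative on the torus is the same as being one, after periodic extension, on the
whole space. -/
lemma isWeakDerivOn_fold_iff {a b : Fin d → ℝ} (hab : ∀ i, a i < b i) {w g : Pt d → ℝ}
    (hw : IntegrableOn w (cell a b)) (hg : IntegrableOn g (cell a b)) (e : Pt d) :
    IsWeakDerivOn volume Set.univ (fun x => w (fold a b x)) (fun x => g (fold a b x)) e ↔
      ∀ φ, (periodic a b).IsTest φ → ∫ x in (periodic a b).dom, w x * fderiv ℝ φ x e =
        -∫ x in (periodic a b).dom, g x * φ x := by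
  have key : ∀ φ : Pt d → ℝ, ContDiff ℝ ∞ φ → HasCompactSupport φ →
      ∫ x, w (fold a b x) * fderiv ℝ φ x e =
        ∫ x in (periodic a b).dom, w x * fderiv ℝ (periodize a b φ) x e := by
    intro φ hφ hc
    simp only [fderiv_periodize hab hφ hc]
    exact integral_fold_mul hab hw
      ((hφ.continuous_fderiv (by simp)).clm_apply continuous_const) (hc.fderiv_apply ℝ e)
  constructor
  · intro h φ hφ
    obtain ⟨ψ, h1, h2, rfl⟩ := exists_periodize_eq hab hφ.contDiff (add_period_eq_of_isTest hφ)
    rw [← key ψ h1 h2, h ψ h1 h2 (Set.subset_univ _), integral_fold_mul hab hg h1.continuous h2]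
  · intro h φ hφ hc _
    rw [key φ hφ hc, h _ (isTest_periodize hab hφ hc), integral_fold_mul hab hg hφ.continuous hc]

/-- In the Neumann case, weak derivatives may be computed after extension by zero. -/
lemma isWeakDerivOn_iff_neumann {Ω : Set (Pt d)} (hΩ : MeasurableSet Ω) {w g W H : Pt d → ℝ}
    (hw : ∀ x ∈ Ω, W x = w x) (hg : ∀ᵐ x ∂(volume.restrict Ω), H x = g x) (e : Pt d) :
    IsWeakDerivOn volume Ω W H e ↔ ∀ φ, (neumann Ω).IsTest φ →
      ∫ x in Ω, w x * fderiv ℝ φ x e = -∫ x in Ω, g x * φ x := by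
  have key : ∀ φ : Pt d → ℝ, tsupport φ ⊆ Ω →
      ∫ x, W x * fderiv ℝ φ x e = ∫ x in Ω, w x * fderiv ℝ φ x e ∧
      ∫ x, H x * φ x = ∫ x in Ω, g x * φ x := by
    intro φ hφ
    constructor
    · rw [← setIntegral_eq_integral_of_forall_compl_eq_zero (s := Ω)]
      · exact setIntegral_congr_fun hΩ fun x hx => by simp only [hw x hx]
      · intro x hx
        rw [image_eq_zero_of_notMem_tsupport (f := fun x => fderiv ℝ φ x e)
          (fun h => hx (hφ (tsupport_fderiv_apply_subset ℝ e h))), mul_zero]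
    · rw [← setIntegral_eq_integral_of_forall_compl_eq_zero (s := Ω)]
      · refine integral_congr_ae ?_
        filter_upwards [hg] with x hx
        rw [hx]
      · intro x hx
        rw [image_eq_zero_of_notMem_tsupport (fun h => hx (hφ h)), mul_zero]
  constructor
  · rintro h φ ⟨h1, h2, h3⟩
    rw [← (key φ h3).1, ← (key φ h3).2]
    exact h φ h1 h2 h3
  · intro h φ h1 h2 h3
    rw [(key φ h3).1, (key φ h3).2]
    exact h φ ⟨h1, h2, h3⟩

lemma hasWeakGradient_one (hS : S.IsAdmissible) :
    S.HasWeakGradient (fun _ => 1) (fun _ => 0) := by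
  have := isFiniteMeasure_restrict_dom hS
  refine ⟨memLp_const 1, MemLp.zero', fun φ hφ i => ?_⟩
  have hone : ∀ U : Set (Pt d),
      IsWeakDerivOn volume U (fun _ : Pt d => (1 : ℝ)) (fun _ => 0) (coordVec i) := by
    intro U χ h1 h2 _
    have hd : Continuous fun x => fderiv ℝ χ x (coordVec i) :=
      (h1.continuous_fderiv (by simp)).clm_apply continuous_const
    have h := integral_mul_fderiv_eq_neg_fderiv_mul_of_integrable (μ := volume)
      (f := fun _ : Pt d => (1 : ℝ)) (g := χ) (v := coordVec i) (by simp)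
      (by simpa using hd.integrable_of_hasCompactSupport (h2.fderiv_apply ℝ _))
      (by simpa using h1.continuous.integrable_of_hasCompactSupport h2)
      (fun x _ => by fun_prop) (fun x _ => h1.differentiable (by simp) x)
    simpa using h
  cases S with
  | periodic a b =>
    have hfin : volume (cell a b) ≠ ⊤ := isBounded_cell.measure_lt_top.ne
    exact (isWeakDerivOn_fold_iff hS (w := fun _ => 1) (g := fun _ => 0)
      (integrableOn_const hfin) integrableOn_zero _).1 (hone _) φ hφ
  | neumann Ω =>
    exact (isWeakDerivOn_iff_neumann (W := fun _ => 1) (H := fun _ => 0) hS.1.measurableSet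
      (fun _ _ => rfl) (Eventually.of_forall fun _ => rfl) _).1 (hone _) φ hφ

/-- Chain rule in `H¹`, respectively `H¹_per`, for functions continuous up to the boundary. -/
lemma HasWeakGradient.comp (hS : S.IsAdmissible) {w : Pt d → ℝ} {G : Pt d → Pt d}
    (h : S.HasWeakGradient w G) (hw : ContinuousOn w (closure S.dom)) {η η' : ℝ → ℝ}
    (hη : ∀ y, HasDerivAt η (η' y) y) (hη' : Continuous η') :
    S.HasWeakGradient (fun x => η (w x)) (fun x => η' (w x) • G x) := by
  have hfm := isFiniteMeasure_restrict_dom hS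
  have hDo := isOpen_dom hS
  have hD := hDo.measurableSet
  have hηc : Continuous η := continuous_iff_continuousAt.2 fun y => (hη y).continuousAt
  have hwD : ContinuousOn w S.dom := hw.mono subset_closure
  obtain ⟨C, hC⟩ := (isCompact_closure_dom hS).exists_bound_of_continuousOn hw
  obtain ⟨M, hM⟩ := (isCompact_closure_dom hS).exists_bound_of_continuousOn
    (hηc.comp_continuousOn hw)
  obtain ⟨M', hM'⟩ := (isCompact_closure_dom hS).exists_bound_of_continuousOn
    (hη'.comp_continuousOn hw)
  obtain ⟨-, hG, hwG⟩ := h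
  refine ⟨?_, ?_, fun φ hφ i => ?_⟩
  · refine MemLp.of_bound ((hηc.comp_continuousOn hwD).aestronglyMeasurable hD) M ?_
    filter_upwards [ae_restrict_mem hD] with x hx using hM x (subset_closure hx)
  · refine hG.of_le_mul (c := M')
      (((hη'.comp_continuousOn hwD).aestronglyMeasurable hD).smul hG.1) ?_
    filter_upwards [ae_restrict_mem hD] with x hx
    rw [norm_smul]
    exact mul_le_mul_of_nonneg_right (hM' x (subset_closure hx)) (norm_nonneg _)
  -- representatives that are measurable on the whole space
  set W : Pt d → ℝ := S.dom.indicator w with hW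
  have hWm : Measurable W := by
    classical
    rw [hW, ← Set.piecewise_eq_indicator]
    exact hwD.measurable_piecewise continuousOn_const hD
  have hWD : ∀ x ∈ S.dom, W x = w x := fun x hx => Set.indicator_of_mem hx _
  have hWC : ∀ x, |W x| ≤ max C 0 := by
    intro x
    by_cases hx : x ∈ S.dom
    · rw [hWD x hx]
      exact (hC x (subset_closure hx)).trans (le_max_left _ _)
    · simp [hW, hx]
  have hWc : ∀ x ∈ S.dom, ContinuousAt W x := by
    intro x hx
    refine (hwD.continuousAt (hDo.mem_nhds hx)).congr ?_
    filter_upwards [hDo.mem_nhds hx] with y hy using (hWD y hy).symm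
  have hGi : MemLp (fun x => G x i) 2 (volume.restrict S.dom) := by
    refine hG.of_le ?_ (Eventually.of_forall fun x => PiLp.norm_apply_le (G x) i)
    exact (by fun_prop : Continuous fun x : Pt d => x i).comp_aestronglyMeasurable hG.1
  set g : Pt d → ℝ := hGi.1.mk _ with hg
  have hgm : Measurable g := hGi.1.stronglyMeasurable_mk.measurable
  have hgG : ∀ᵐ x ∂(volume.restrict S.dom), g x = G x i := hGi.1.ae_eq_mk.symm
  have hgint : IntegrableOn g S.dom :=
    ((hGi.integrable (by norm_num)).congr hGi.1.ae_eq_mk)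
  have hM'' : ∀ x ∈ S.dom, ‖η' (W x)‖ ≤ M' := fun x hx => by
    rw [hWD x hx]; exact hM' x (subset_closure hx)
  have hηint : IntegrableOn (fun x => η (W x)) S.dom := by
    refine Measure.integrableOn_of_bounded (M := M) (volume_dom_lt_top hS).ne
      (hηc.measurable.comp hWm).aestronglyMeasurable ?_
    filter_upwards [ae_restrict_mem hD] with x hx
    rw [hWD x hx]; exact hM x (subset_closure hx)
  have hη'int : IntegrableOn (fun x => η' (W x) * g x) S.dom := by
    refine Integrable.bdd_mul hgint
      ((hη'.measurable.comp hWm).aestronglyMeasurable) (c := M') ?_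
    filter_upwards [ae_restrict_mem hD] with x hx using hM'' x hx
  have hWint : IntegrableOn W S.dom := by
    refine Measure.integrableOn_of_bounded (volume_dom_lt_top hS).ne
      hWm.aestronglyMeasurable (Eventually.of_forall hWC)
  have hfin : ∫ x in S.dom, η (W x) * fderiv ℝ φ x (coordVec i) =
      -∫ x in S.dom, η' (W x) * g x * φ x := by
    have hwg : ∀ χ, S.IsTest χ → ∫ x in S.dom, W x * fderiv ℝ χ x (coordVec i) =
        -∫ x in S.dom, g x * χ x := by
      intro χ hχ
      have h1 := hwG χ hχ i
      rw [setIntegral_congr_fun hD (g := fun x => w x * fderiv ℝ χ x (coordVec i))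
        (fun x hx => by simp only [hWD x hx]), h1]
      congr 1
      refine integral_congr_ae ?_
      filter_upwards [hgG] with x hx
      rw [hx]
    cases S with
    | periodic a b =>
      have hset : ∀ {f : Pt d → ℝ}, IntegrableOn f (periodic a b).dom →
          IntegrableOn f (cell a b) := fun hf => hf.congr_set_ae dom_ae_eq_cell.symm
      have h1 := (isWeakDerivOn_fold_iff hS (hset hWint) (hset hgint) (coordVec i)).2 hwg
      have h2 := h1.comp isOpen_univ (fun x => hWC _) (hWm.comp measurable_fold)
        (by
          filter_upwards [ae_fold_mem_dom hS] with x hx _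
          exact (hWc _ hx).comp (continuousAt_fold hS hx))
        (locallyIntegrable_comp_fold hS (hset hgint)) (hgm.comp measurable_fold) hη hη'
      exact (isWeakDerivOn_fold_iff hS (w := fun x => η (W x)) (g := fun x => η' (W x) * g x)
        (hset hηint) (hset hη'int) (coordVec i)).1 h2 φ hφ
    | neumann Ω =>
      have hH : ∀ᵐ x ∂(volume.restrict Ω), Ω.indicator g x = g x := by
        filter_upwards [ae_restrict_mem hD] with x hx using Set.indicator_of_mem hx _
      have h1 := (isWeakDerivOn_iff_neumann hD (w := W) (W := W) (fun _ _ => rfl) hH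
        (coordVec i)).2 hwg
      have h2 := h1.comp hDo hWC hWm (Eventually.of_forall hWc)
        (hgint.integrable_indicator hD).locallyIntegrable (hgm.indicator hD) hη hη'
      refine (isWeakDerivOn_iff_neumann hD (w := fun x => η (W x))
        (g := fun x => η' (W x) * g x) (fun _ _ => rfl) ?_ (coordVec i)).1 h2 φ hφ
      filter_upwards [hH] with x hx
      exact congrArg (η' (W x) * ·) hx
  rw [setIntegral_congr_fun hD (g := fun x => η (W x) * fderiv ℝ φ x (coordVec i))
    (fun x hx => by simp only [hWD x hx]), hfin]
  congr 1
  refine integral_congr_ae ?_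
  filter_upwards [hgG, ae_restrict_mem hD] with x hx hxD
  rw [hx, hWD x hxD]
  simp

lemma IsLaplacian.integral_eq_zero (hS : S.IsAdmissible) {u l : Pt d → ℝ}
    (h : S.IsLaplacian u l) : ∫ x in S.dom, l x = 0 := by
  obtain ⟨-, -, G, -, hG⟩ := h
  simpa using hG _ _ (hasWeakGradient_one hS)

/-- Testing the Laplacian of `u` with a nondecreasing function of `u`. -/
lemma IsLaplacian.integral_mul_comp_nonpos (hS : S.IsAdmissible) {u l : Pt d → ℝ}
    (h : S.IsLaplacian u l) {η η' : ℝ → ℝ} (hη : ∀ y, HasDerivAt η (η' y) y)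
    (hη' : Continuous η') (hpos : ∀ y, 0 ≤ η' y) : ∫ x in S.dom, l x * η (u x) ≤ 0 := by
  obtain ⟨hu, -, G, hG, hl⟩ := h
  have h1 := hl _ _ (hG.comp hS hu.1 hη hη')
  have h2 : 0 ≤ ∫ x in S.dom, inner ℝ (G x) (η' (u x) • G x) := by
    refine integral_nonneg fun x => ?_
    rw [inner_smul_right]
    exact mul_nonneg (hpos _) real_inner_self_nonneg
  linarith

end BVSetting
/-! ### Integrals along an evolution, and the convex penalty -/

open Filter Topology

variable {d : ℕ} {S : BVSetting d}

lemma integrableOn_dom (hS : S.IsAdmissible) {f : Pt d → ℝ} (hf : ContinuousOn f (closure S.dom)) :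
    IntegrableOn f S.dom :=
  (hf.integrableOn_compact (BVSetting.isCompact_closure_dom hS)).mono_set subset_closure

lemma continuousOn_slice {X Y : Type*} [TopologicalSpace X] [TopologicalSpace Y] {f : X → Y → ℝ}
    {I : Set X} {K : Set Y} (hf : ContinuousOn (fun p : X × Y => f p.1 p.2) (I ×ˢ K)) {s : X}
    (hs : s ∈ I) : ContinuousOn (f s) K :=
  hf.comp (f := fun x => (s, x)) (by fun_prop) fun _ hx => ⟨hs, hx⟩

/-- A nonnegative continuous function on `Ω̄` with zero integral vanishes. -/
lemma eqOn_zero_of_setIntegral_eq_zero (hS : S.IsAdmissible) {f : Pt d → ℝ}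
    (hf : ContinuousOn f (closure S.dom)) (h0 : ∀ x ∈ closure S.dom, 0 ≤ f x)
    (h : ∫ x in S.dom, f x = 0) : ∀ x ∈ closure S.dom, f x = 0 := by
  have hDo := BVSetting.isOpen_dom hS
  have hnn : 0 ≤ᵐ[volume.restrict S.dom] f := by
    filter_upwards [ae_restrict_mem hDo.measurableSet] with x hx using h0 x (subset_closure hx)
  have h1 := (setIntegral_eq_zero_iff_of_nonneg_ae hnn (integrableOn_dom hS hf)).1 h
  have h2 : Set.EqOn f 0 S.dom := Measure.eqOn_open_of_ae_eq h1 hDo (hf.mono subset_closure)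
    continuousOn_const
  exact h2.of_subset_closure hf continuousOn_const subset_closure subset_rfl

lemma continuousOn_integral_comp (hS : S.IsAdmissible) {τ : ℝ} {w : ℝ → Pt d → ℝ}
    (hw : ContinuousOn (fun p : ℝ × Pt d => w p.1 p.2) (Set.Icc 0 τ ×ˢ closure S.dom))
    {Φ : ℝ → ℝ} (hΦ : Continuous Φ) :
    ContinuousOn (fun s => ∫ x in S.dom, Φ (w s x)) (Set.Icc 0 τ) := by
  have hfm := BVSetting.isFiniteMeasure_restrict_dom hS
  have hD := BVSetting.measurableSet_dom hS
  have hc := hΦ.comp_continuousOn hw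
  obtain ⟨C, hC⟩ := (isCompact_Icc.prod
    (BVSetting.isCompact_closure_dom hS)).exists_bound_of_continuousOn hc
  refine continuousOn_of_dominated (bound := fun _ => C) (fun s hs => ?_) (fun s hs => ?_)
    (integrable_const C) ?_
  · exact ((continuousOn_slice (f := fun s x => Φ (w s x)) hc hs).mono
      subset_closure).aestronglyMeasurable hD
  · filter_upwards [ae_restrict_mem hD] with x hx using hC (s, x) ⟨hs, subset_closure hx⟩
  · filter_upwards [ae_restrict_mem hD] with x hx
    exact hc.comp (f := fun s => (s, x)) (by fun_prop) fun s hs => ⟨hs, subset_closure hx⟩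

lemma hasDerivAt_integral_comp (hS : S.IsAdmissible) {τ : ℝ} {w z : ℝ → Pt d → ℝ}
    (hw : ContinuousOn (fun p : ℝ × Pt d => w p.1 p.2) (Set.Icc 0 τ ×ˢ closure S.dom))
    (hz : ContinuousOn (fun p : ℝ × Pt d => z p.1 p.2) (Set.Ioc 0 τ ×ˢ closure S.dom))
    (hwz : ∀ s ∈ Set.Ioc 0 τ, ∀ x ∈ S.dom,
      HasDerivWithinAt (fun r => w r x) (z s x) (Set.Icc 0 τ) s)
    {Φ Φ' : ℝ → ℝ} (hΦ : ∀ y, HasDerivAt Φ (Φ' y) y) (hΦ' : Continuous Φ') {s : ℝ}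
    (hs : s ∈ Set.Ioo 0 τ) :
    HasDerivAt (fun r => ∫ x in S.dom, Φ (w r x)) (∫ x in S.dom, Φ' (w s x) * z s x) s := by
  have hfm := BVSetting.isFiniteMeasure_restrict_dom hS
  have hD := BVSetting.measurableSet_dom hS
  have hΦc : Continuous Φ := continuous_iff_continuousAt.2 fun y => (hΦ y).continuousAt
  -- away from `s = 0` the time derivative is bounded
  obtain ⟨α, hα0, hαs⟩ := exists_between hs.1
  obtain ⟨β, hsβ, hβτ⟩ := exists_between hs.2
  have hsub : Set.Icc α β ⊆ Set.Ioc 0 τ := fun r hr => ⟨hα0.trans_le hr.1, hr.2.trans hβτ.le⟩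
  have hsub' : Set.Icc α β ⊆ Set.Icc 0 τ := hsub.trans Set.Ioc_subset_Icc_self
  have hc : ContinuousOn (fun p : ℝ × Pt d => Φ' (w p.1 p.2) * z p.1 p.2)
      (Set.Icc α β ×ˢ closure S.dom) :=
    (hΦ'.comp_continuousOn (hw.mono (Set.prod_mono hsub' subset_rfl))).mul
      (hz.mono (Set.prod_mono hsub subset_rfl))
  obtain ⟨C, hC⟩ := (isCompact_Icc.prod
    (BVSetting.isCompact_closure_dom hS)).exists_bound_of_continuousOn hc
  have hnhds : Set.Icc α β ∈ 𝓝 s := Icc_mem_nhds hαs hsβ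
  have hΦw : ∀ r ∈ Set.Icc 0 τ, ContinuousOn (fun x => Φ (w r x)) (closure S.dom) :=
    fun r hr => hΦc.comp_continuousOn (continuousOn_slice hw hr)
  refine (hasDerivAt_integral_of_dominated_loc_of_deriv_le (bound := fun _ => C)
    (F' := fun r x => Φ' (w r x) * z r x) hnhds ?_ ?_ ?_ ?_ (integrable_const C) ?_).2
  · filter_upwards [hnhds] with r hr
    exact ((hΦw r (hsub' hr)).mono subset_closure).aestronglyMeasurable hD
  · exact integrableOn_dom hS (hΦw s (Set.Ioo_subset_Icc_self hs))
  · exact ((continuousOn_slice (f := fun r x => Φ' (w r x) * z r x) hc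
      ⟨hαs.le, hsβ.le⟩).mono subset_closure).aestronglyMeasurable hD
  · filter_upwards [ae_restrict_mem hD] with x hx r hr using hC (r, x) ⟨hr, subset_closure hx⟩
  · filter_upwards [ae_restrict_mem hD] with x hx r hr
    have h1 : HasDerivAt (fun r => w r x) (z r x) r :=
      (hwz r (hsub hr) x hx).hasDerivAt (Icc_mem_nhds (hα0.trans_le hr.1) (hr.2.trans_lt hβτ))
    exact (hΦ _).comp r h1

lemma hasDerivAt_max_zero_pow (n : ℕ) (y : ℝ) :
    HasDerivAt (fun y : ℝ => max y 0 ^ (n + 2)) ((n + 2) * max y 0 ^ (n + 1)) y := by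
  have hpow : ∀ y : ℝ, HasDerivAt (fun y : ℝ => y ^ (n + 2)) ((n + 2) * y ^ (n + 1)) y := by
    intro y
    simpa using hasDerivAt_pow (n + 2) y
  rcases lt_trichotomy y 0 with hy | rfl | hy
  · have h1 : (fun y : ℝ => max y 0 ^ (n + 2)) =ᶠ[𝓝 y] fun _ => 0 := by
      filter_upwards [Iio_mem_nhds hy] with t ht
      rw [max_eq_right (le_of_lt ht)]
      simp
    rw [max_eq_right hy.le]
    simpa using (hasDerivAt_const y (0 : ℝ)).congr_of_eventuallyEq h1
  · rw [← hasDerivWithinAt_univ, ← Set.Iic_union_Ici (a := (0 : ℝ))]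
    refine HasDerivWithinAt.union ?_ ?_
    · have h1 : HasDerivWithinAt (fun _ : ℝ => (0 : ℝ)) 0 (Set.Iic 0) 0 :=
        hasDerivWithinAt_const _ _ _
      simp only [max_self, ne_eq, Nat.add_eq_zero_iff, one_ne_zero, and_false, not_false_eq_true,
        zero_pow, mul_zero]
      exact h1.congr (fun t ht => by rw [max_eq_right ht]; simp) (by simp)
    · have h1 := (hpow 0).hasDerivWithinAt (s := Set.Ici 0)
      rw [max_self]
      exact h1.congr (fun t ht => by rw [max_eq_left ht]) (by simp)
  · have h1 : (fun y : ℝ => max y 0 ^ (n + 2)) =ᶠ[𝓝 y] fun y => y ^ (n + 2) := by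
      filter_upwards [Ioi_mem_nhds hy] with t ht
      rw [max_eq_left (le_of_lt ht)]
    rw [max_eq_left hy.le]
    exact (hpow y).congr_of_eventuallyEq h1

/-- A convex `C²` function that vanishes exactly on `[-1, 1]`. -/
lemma exists_convex_penalty : ∃ Φ η η' : ℝ → ℝ, (∀ y, HasDerivAt Φ (η y) y) ∧
    (∀ y, HasDerivAt η (η' y) y) ∧ Continuous η' ∧ (∀ y, 0 ≤ η' y) ∧ (∀ y, 0 ≤ Φ y) ∧
    (∀ y, Φ y = 0 ↔ |y| ≤ 1) ∧ (∀ y, |y| ≤ 1 → η y = 0) ∧ (∀ y, 1 < y → 0 ≤ η y) ∧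
    ∀ y, y < -1 → η y ≤ 0 := by
  refine ⟨fun y => max (y - 1) 0 ^ 3 + max (-y - 1) 0 ^ 3,
    fun y => 3 * (max (y - 1) 0 ^ 2 - max (-y - 1) 0 ^ 2),
    fun y => 6 * (max (y - 1) 0 + max (-y - 1) 0), fun y => ?_, fun y => ?_, by fun_prop,
    fun y => by positivity, fun y => by positivity, fun y => ⟨fun h => ?_, fun h => ?_⟩,
    fun y h => ?_, fun y h => ?_, fun y h => ?_⟩
  · have h1 := (hasDerivAt_max_zero_pow 1 (y - 1)).comp y ((hasDerivAt_id y).sub_const 1)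
    have h2 := (hasDerivAt_max_zero_pow 1 (-y - 1)).comp y ((hasDerivAt_id y).neg.sub_const 1)
    refine (h1.add h2).congr_deriv ?_
    norm_num
    ring
  · have h1 := (hasDerivAt_max_zero_pow 0 (y - 1)).comp y ((hasDerivAt_id y).sub_const 1)
    have h2 := (hasDerivAt_max_zero_pow 0 (-y - 1)).comp y ((hasDerivAt_id y).neg.sub_const 1)
    refine ((h1.sub h2).const_mul 3).congr_deriv ?_
    norm_num
    ring
  · have h1 : 0 ≤ max (y - 1) 0 ^ 3 := by positivity
    have h2 : 0 ≤ max (-y - 1) 0 ^ 3 := by positivity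
    have h3 : max (y - 1) 0 = 0 := pow_eq_zero_iff (n := 3) (by norm_num) |>.1 (by linarith)
    have h4 : max (-y - 1) 0 = 0 := pow_eq_zero_iff (n := 3) (by norm_num) |>.1 (by linarith)
    rw [abs_le]
    constructor <;> linarith [max_eq_right_iff.1 h3, max_eq_right_iff.1 h4]
  · have h' := abs_le.1 h
    simp only
    rw [max_eq_right (by linarith), max_eq_right (by linarith)]
    norm_num
  · have h' := abs_le.1 h
    simp only
    rw [max_eq_right (by linarith), max_eq_right (by linarith)]
    norm_num
  · simp only
    rw [max_eq_right (a := -y - 1) (by linarith)]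
    have := sq_nonneg (max (y - 1) 0)
    linarith
  · simp only
    rw [max_eq_right (a := y - 1) (by linarith)]
    have := sq_nonneg (max (-y - 1) 0)
    linarith

/-! ### Mass balance and maximum bound principle for one time step -/

section Step

variable {ε κ τ : ℝ} {F : ℝ → Pt d → ℝ} {u v : Pt d → ℝ}

lemma IsETDStep.continuousOn (hτ : 0 < τ) (h : IsETDStep S ε κ τ F u v) :
    ContinuousOn v (closure S.dom) := by
  obtain ⟨w, l, hw, -, -, -, -, hv⟩ := h
  exact (continuousOn_slice hw ⟨hτ.le, le_rfl⟩).congr hv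

/-- Mass balance of one step: as the Laplacian has mean zero, `m(s) = ∫ w(s)` solves
`m' = -κ (m - m(0))`. -/
lemma IsETDStep.integral_eq (hS : S.IsAdmissible) (hτ : 0 < τ) (h : IsETDStep S ε κ τ F u v)
    (hF : ContinuousOn (fun p : ℝ × Pt d => F p.1 p.2) (Set.Icc 0 τ ×ˢ closure S.dom))
    (hFm : ∀ s ∈ Set.Icc 0 τ, ∫ x in S.dom, F s x = κ * ∫ x in S.dom, u x) :
    ∫ x in S.dom, v x = ∫ x in S.dom, u x := by
  obtain ⟨w, l, hw, hl, hL, hd, hu, hv⟩ := h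
  have hD := BVSetting.measurableSet_dom hS
  set m : ℝ → ℝ := fun s => ∫ x in S.dom, w s x with hm
  have hsub : Set.Ioc 0 τ ⊆ Set.Icc 0 τ := Set.Ioc_subset_Icc_self
  have hz : ContinuousOn (fun p : ℝ × Pt d => ε ^ 2 * l p.1 p.2 - κ * w p.1 p.2 + F p.1 p.2)
      (Set.Ioc 0 τ ×ˢ closure S.dom) :=
    ((hl.const_mul (ε ^ 2)).sub ((hw.mono (Set.prod_mono hsub subset_rfl)).const_mul κ)).add
      (hF.mono (Set.prod_mono hsub subset_rfl))
  have hm0 : m 0 = ∫ x in S.dom, u x :=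
    setIntegral_congr_fun hD fun x hx => hu x (subset_closure hx)
  have hmτ : ∫ x in S.dom, v x = m τ :=
    setIntegral_congr_fun hD fun x hx => hv x (subset_closure hx)
  have hmd : ∀ s ∈ Set.Ioo 0 τ, HasDerivAt m (-κ * m s + κ * m 0) s := by
    intro s hs
    have hs' : s ∈ Set.Ioc 0 τ := Set.Ioo_subset_Ioc_self hs
    have h1 := hasDerivAt_integral_comp hS hw (z := fun s x => ε ^ 2 * l s x - κ * w s x + F s x)
      hz hd (Φ := fun y => y) (Φ' := fun _ => 1) (fun y => hasDerivAt_id' y) continuous_const hs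
    have i1 := integrableOn_dom hS (continuousOn_slice hl hs')
    have i2 := integrableOn_dom hS (continuousOn_slice hw (hsub hs'))
    have i3 := integrableOn_dom hS (continuousOn_slice hF (hsub hs'))
    refine h1.congr_deriv ?_
    have i12 : IntegrableOn (fun x => ε ^ 2 * l s x - κ * w s x) S.dom :=
      (i1.const_mul _).sub (i2.const_mul _)
    simp only [one_mul]
    rw [integral_add i12 i3, integral_sub (i1.const_mul _) (i2.const_mul _), integral_const_mul,
      integral_const_mul, (hL s hs').integral_eq_zero hS, hFm s (hsub hs'), hm0]
    ring
  have hmc : ContinuousOn m (Set.Icc 0 τ) := continuousOn_integral_comp hS hw continuous_id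
  -- `exp (κ s) (m s - m 0)` has zero derivative on `(0, τ)` and is continuous up to `s = 0`, where
  -- the equation itself is not available
  have hcont : ContinuousOn (fun s => Real.exp (κ * s) * (m s - m 0)) (Set.Icc 0 τ) :=
    (by fun_prop : Continuous fun s => Real.exp (κ * s)).continuousOn.mul
      (hmc.sub continuousOn_const)
  obtain ⟨c, -, hc⟩ := exists_hasDerivAt_eq_slope _ (fun _ => 0) hτ hcont fun s hs => by
    have h1 : HasDerivAt (fun s => Real.exp (κ * s)) (Real.exp (κ * s) * κ) s := by
      simpa using ((hasDerivAt_id s).const_mul κ).exp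
    refine (h1.mul ((hmd s hs).sub_const (m 0))).congr_deriv ?_
    ring
  rw [eq_comm, div_eq_zero_iff, or_iff_left (by linarith), sub_self, mul_zero, sub_zero,
    mul_eq_zero, or_iff_right (Real.exp_pos _).ne', sub_eq_zero] at hc
  rw [hmτ, hc, hm0]

/-- Maximum bound principle for one step: for a convex penalty `Φ` of the set `[-1, 1]`, the energy
`∫ Φ(w(s))` does not increase. -/
lemma IsETDStep.abs_le_one (hS : S.IsAdmissible) (hκ : 0 < κ) (hτ : 0 < τ)
    (h : IsETDStep S ε κ τ F u v)
    (hF : ContinuousOn (fun p : ℝ × Pt d => F p.1 p.2) (Set.Icc 0 τ ×ˢ closure S.dom))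
    (hFκ : ∀ s ∈ Set.Icc 0 τ, ∀ x ∈ closure S.dom, |F s x| ≤ κ)
    (hu1 : ∀ x ∈ closure S.dom, |u x| ≤ 1) : ∀ x ∈ closure S.dom, |v x| ≤ 1 := by
  obtain ⟨w, l, hw, hl, hL, hd, hu, hv⟩ := h
  obtain ⟨Φ, η, η', hΦ, hη, hη', hη'0, hΦ0, hΦ1, hη0, hηp, hηn⟩ := exists_convex_penalty
  have hD := BVSetting.measurableSet_dom hS
  have hΦc : Continuous Φ := continuous_iff_continuousAt.2 fun y => (hΦ y).continuousAt
  have hηc : Continuous η := continuous_iff_continuousAt.2 fun y => (hη y).continuousAt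
  have hsub : Set.Ioc 0 τ ⊆ Set.Icc 0 τ := Set.Ioc_subset_Icc_self
  have hz : ContinuousOn (fun p : ℝ × Pt d => ε ^ 2 * l p.1 p.2 - κ * w p.1 p.2 + F p.1 p.2)
      (Set.Ioc 0 τ ×ˢ closure S.dom) :=
    ((hl.const_mul (ε ^ 2)).sub ((hw.mono (Set.prod_mono hsub subset_rfl)).const_mul κ)).add
      (hF.mono (Set.prod_mono hsub subset_rfl))
  set J : ℝ → ℝ := fun s => ∫ x in S.dom, Φ (w s x) with hJ
  set J' : ℝ → ℝ := fun s =>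
    ∫ x in S.dom, η (w s x) * (ε ^ 2 * l s x - κ * w s x + F s x) with hJ'
  have hJd : ∀ s ∈ Set.Ioo 0 τ, HasDerivAt J (J' s) s := fun s hs =>
    hasDerivAt_integral_comp hS hw (z := fun s x => ε ^ 2 * l s x - κ * w s x + F s x)
      hz hd hΦ hηc hs
  have hJ'0 : ∀ s ∈ Set.Ioo 0 τ, J' s ≤ 0 := by
    intro s hs
    have hs' : s ∈ Set.Ioc 0 τ := Set.Ioo_subset_Ioc_self hs
    have c1 := continuousOn_slice hl hs'
    have c2 := continuousOn_slice hw (hsub hs')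
    have c3 := continuousOn_slice hF (hsub hs')
    have c4 := hηc.comp_continuousOn c2
    have i1 : IntegrableOn (fun x => l s x * η (w s x)) S.dom := integrableOn_dom hS (c1.mul c4)
    have i2 : IntegrableOn (fun x => η (w s x) * (F s x - κ * w s x)) S.dom :=
      integrableOn_dom hS (c4.mul (c3.sub (c2.const_mul κ)))
    have e1 : J' s = ε ^ 2 * (∫ x in S.dom, l s x * η (w s x)) +
        ∫ x in S.dom, η (w s x) * (F s x - κ * w s x) := by
      rw [← integral_const_mul, ← integral_add (i1.const_mul _) i2]
      refine integral_congr_ae (Eventually.of_forall fun x => ?_)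
      ring
    have h1 := (hL s hs').integral_mul_comp_nonpos hS hη hη' hη'0
    have h2 : ∫ x in S.dom, η (w s x) * (F s x - κ * w s x) ≤ 0 := by
      refine setIntegral_nonpos hD fun x hx => ?_
      have hFx := abs_le.1 (hFκ s (hsub hs') x (subset_closure hx))
      rcases le_or_gt |w s x| 1 with hle | hgt
      · rw [hη0 _ hle, zero_mul]
      · rcases lt_abs.1 hgt with hp | hn
        · exact mul_nonpos_of_nonneg_of_nonpos (hηp _ hp) (by nlinarith)
        · exact mul_nonpos_of_nonpos_of_nonneg (hηn _ (by linarith)) (by nlinarith)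
    rw [e1]
    have := mul_nonneg (sq_nonneg ε) (neg_nonneg.2 h1)
    linarith
  obtain ⟨c, hc, hslope⟩ := exists_hasDerivAt_eq_slope J J' hτ
    (continuousOn_integral_comp hS hw hΦc) hJd
  have hJ0 : J 0 = 0 := by
    refine setIntegral_eq_zero_of_forall_eq_zero fun x hx => ?_
    rw [hu x (subset_closure hx)]
    exact (hΦ1 _).2 (hu1 x (subset_closure hx))
  have hJτ : J τ ≤ 0 := by
    have h1 := hJ'0 c hc
    rw [hslope, hJ0, sub_zero, sub_zero] at h1
    by_contra hcon
    exact absurd (div_pos (not_le.1 hcon) hτ) (not_lt.2 h1)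
  have hJτ0 : J τ = 0 := le_antisymm hJτ (integral_nonneg fun x => hΦ0 _)
  intro x hx
  rw [hv x hx]
  exact (hΦ1 _).1 (eqOn_zero_of_setIntegral_eq_zero hS
    (hΦc.comp_continuousOn (continuousOn_slice hw ⟨hτ.le, le_rfl⟩)) (fun y _ => hΦ0 _) hJτ0 x hx)

end Step

/-! ### The stabilised nonlinearity -/

section Nonlinearity

variable {κ : ℝ} {u : Pt d → ℝ}

lemma continuousOn_nonlin {K : Set (Pt d)} (hu : ContinuousOn u K) :
    ContinuousOn (nonlin S κ u) K := by
  unfold nonlin fAC gAC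
  fun_prop

/-- The multiplier is chosen such that `f(u) - λ_u g(u)` has mean zero. -/
lemma integral_nonlin (hS : S.IsAdmissible) (hu : ContinuousOn u (closure S.dom))
    (hg : gMass S u ≠ 0) : ∫ x in S.dom, nonlin S κ u x = κ * ∫ x in S.dom, u x := by
  have i1 : IntegrableOn (fun x => κ * u x) S.dom := (integrableOn_dom hS hu).const_mul κ
  have i2 : IntegrableOn (fun x => fAC (u x)) S.dom :=
    integrableOn_dom hS (by unfold fAC; fun_prop)
  have i3 : IntegrableOn (fun x => multiplier S u * gAC (u x)) S.dom :=
    integrableOn_dom hS (by unfold gAC; fun_prop)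
  have i12 : IntegrableOn (fun x => κ * u x + fAC (u x)) S.dom := i1.add i2
  unfold nonlin
  rw [integral_sub i12 i3, integral_add i1 i2, integral_const_mul, integral_const_mul]
  have h : multiplier S u * ∫ x in S.dom, gAC (u x) = ∫ x in S.dom, fAC (u x) :=
    div_mul_cancel₀ _ hg
  rw [h]
  ring

/-- As `f(y) = y g(y)` with `g ≥ 0` on `[-1, 1]`, the multiplier of `u` lies in `[-1, 1]` if the
values of `u` do. -/
lemma abs_multiplier_le_one (hS : S.IsAdmissible) (hu : ContinuousOn u (closure S.dom))
    (hu1 : ∀ x ∈ closure S.dom, |u x| ≤ 1) : |multiplier S u| ≤ 1 := by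
  have hD := BVSetting.measurableSet_dom hS
  have hgu : ∀ x ∈ S.dom, 0 ≤ gAC (u x) := fun x hx => by
    have := (sq_le_one_iff_abs_le_one (u x)).2 (hu1 x (subset_closure hx))
    unfold gAC
    linarith
  have hG : 0 ≤ gMass S u := setIntegral_nonneg hD hgu
  rw [multiplier, abs_div, abs_of_nonneg hG]
  refine div_le_one_of_le₀ ?_ hG
  refine abs_integral_le_integral_abs.trans ?_
  refine setIntegral_mono_on (integrableOn_dom hS (by unfold fAC; fun_prop))
    (integrableOn_dom hS (by unfold gAC; fun_prop)) hD fun x hx => ?_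
  have e : fAC (u x) = u x * gAC (u x) := by unfold fAC gAC; ring
  rw [e, abs_mul, abs_of_nonneg (hgu x hx)]
  exact mul_le_of_le_one_left (hgu x hx) (hu1 x (subset_closure hx))

/-- For `κ ≥ 4` the stabilised nonlinearity maps values in `[-1, 1]` to values in `[-κ, κ]`: both
`κ ∓ N[u]` factor, with a factor `1 ∓ u` and a factor that is at least `κ - 4`. -/
lemma abs_nonlin_le (hS : S.IsAdmissible) (hκ : 4 ≤ κ) (hu : ContinuousOn u (closure S.dom))
    (hu1 : ∀ x ∈ closure S.dom, |u x| ≤ 1) : ∀ x ∈ closure S.dom, |nonlin S κ u x| ≤ κ := by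
  intro x hx
  have hl := abs_le.1 (abs_multiplier_le_one hS hu hu1)
  have hy := abs_le.1 (hu1 x hx)
  unfold nonlin fAC gAC
  set y := u x
  set c := multiplier S u
  have h1 : 0 ≤ κ - (1 + y) * (y - c) := by nlinarith
  have h2 : 0 ≤ κ - (1 - y) * (c - y) := by nlinarith
  have h3 := mul_nonneg (sub_nonneg.2 hy.2) h1
  have h4 := mul_nonneg (by linarith : 0 ≤ 1 + y) h2
  rw [abs_le]
  constructor <;> nlinarith

/-- The denominator vanishes only for the constant states `1` and `-1`, by connectedness. -/
lemma gMass_ne_zero (hS : S.IsAdmissible) (hu : ContinuousOn u (closure S.dom))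
    (hu1 : ∀ x ∈ closure S.dom, |u x| ≤ 1)
    (hM : |∫ x in S.dom, u x| ≠ (volume S.dom).toReal) : gMass S u ≠ 0 := by
  intro h
  have hD := BVSetting.measurableSet_dom hS
  have h0 := eqOn_zero_of_setIntegral_eq_zero hS (f := fun x => gAC (u x))
    (by unfold gAC; fun_prop) (fun x hx => by
      have := (sq_le_one_iff_abs_le_one (u x)).2 (hu1 x hx)
      unfold gAC
      linarith) h
  have hsq : Set.EqOn (u ^ 2) ((fun _ => (1 : ℝ)) ^ 2) S.dom := fun x hx => by
    have := h0 x (subset_closure hx)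
    unfold gAC at this
    simp only [Pi.pow_apply]
    linarith
  refine hM ?_
  rcases (BVSetting.isConnected_dom hS).isPreconnected.eq_or_eq_neg_of_sq_eq
    (hu.mono subset_closure) continuousOn_const hsq (fun _ => one_ne_zero) with h1 | h1
  · rw [setIntegral_congr_fun hD h1]
    simp [Measure.real]
  · rw [setIntegral_congr_fun hD h1]
    simp [Measure.real]

lemma continuousOn_const_source {τ : ℝ} {K : Set (Pt d)} {f : Pt d → ℝ} (hf : ContinuousOn f K) :
    ContinuousOn (fun p : ℝ × Pt d => f p.2) (Set.Icc 0 τ ×ˢ K) :=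
  hf.comp continuousOn_snd fun _ hp => hp.2

lemma continuousOn_interp_source {τ : ℝ} {K : Set (Pt d)} {f g : Pt d → ℝ} (hf : ContinuousOn f K)
    (hg : ContinuousOn g K) : ContinuousOn
      (fun p : ℝ × Pt d => (1 - p.1 / τ) * f p.2 + p.1 / τ * g p.2) (Set.Icc 0 τ ×ˢ K) := by
  have h1 : Continuous fun p : ℝ × Pt d => p.1 / τ := by fun_prop
  exact ((continuousOn_const.sub h1.continuousOn).mul (continuousOn_const_source hf)).add
    (h1.continuousOn.mul (continuousOn_const_source hg))

end Nonlinearity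

/-! ### The iterates of the scheme -/

namespace IsETDRK2

variable {ε κ τ : ℝ} {u₀ : Pt d → ℝ} {u p : ℕ → Pt d → ℝ}

lemma continuousOn (hτ : 0 < τ) (hu₀ : S.IsState u₀) (h : IsETDRK2 S ε κ τ u₀ u p) (n : ℕ) :
    ContinuousOn (u n) (closure S.dom) := by
  cases n with
  | zero => exact hu₀.1.congr h.init
  | succ n => exact (h.corrector n).continuousOn hτ

lemma integral_predictor (hS : S.IsAdmissible) (hτ : 0 < τ) (hu₀ : S.IsState u₀)
    (h : IsETDRK2 S ε κ τ u₀ u p) (n : ℕ) (hn : gMass S (u n) ≠ 0) :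
    ∫ x in S.dom, p (n + 1) x = ∫ x in S.dom, u n x :=
  have hu := h.continuousOn hτ hu₀ n
  (h.predictor n).integral_eq hS hτ (continuousOn_const_source (continuousOn_nonlin hu))
    fun _ _ => integral_nonlin hS hu hn

lemma integral_succ (hS : S.IsAdmissible) (hτ : 0 < τ) (hu₀ : S.IsState u₀)
    (h : IsETDRK2 S ε κ τ u₀ u p) (n : ℕ) (hn : gMass S (u n) ≠ 0)
    (hp : gMass S (p (n + 1)) ≠ 0) :
    ∫ x in S.dom, u (n + 1) x = ∫ x in S.dom, u n x := by
  have hu := h.continuousOn hτ hu₀ n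
  have hpc := (h.predictor n).continuousOn hτ
  have cu := continuousOn_nonlin (S := S) (κ := κ) hu
  have cp := continuousOn_nonlin (S := S) (κ := κ) hpc
  refine (h.corrector n).integral_eq hS hτ (continuousOn_interp_source cu cp) fun s _ => ?_
  rw [integral_add ((integrableOn_dom hS cu).const_mul _) ((integrableOn_dom hS cp).const_mul _),
    integral_const_mul, integral_const_mul, integral_nonlin hS hu hn, integral_nonlin hS hpc hp,
    h.integral_predictor hS hτ hu₀ n hn]
  ring

/-- The maximum bound principle of the scheme. It does not need the denominators to be nonzero,
because the bound on the multiplier also holds for the junk value of the quotient. -/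
lemma abs_le_one (hS : S.IsAdmissible) (hτ : 0 < τ) (hκ : 4 ≤ κ) (hu₀ : S.IsState u₀)
    (hu₁ : ∀ x ∈ closure S.dom, |u₀ x| ≤ 1) (h : IsETDRK2 S ε κ τ u₀ u p) (n : ℕ) :
    (∀ x ∈ closure S.dom, |u n x| ≤ 1) ∧ ∀ x ∈ closure S.dom, |p (n + 1) x| ≤ 1 := by
  have hκ0 : 0 < κ := by linarith
  have hpred : ∀ n, (∀ x ∈ closure S.dom, |u n x| ≤ 1) →
      ∀ x ∈ closure S.dom, |p (n + 1) x| ≤ 1 := fun n hn =>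
    have hu := h.continuousOn hτ hu₀ n
    (h.predictor n).abs_le_one hS hκ0 hτ (continuousOn_const_source (continuousOn_nonlin hu))
      (fun _ _ => abs_nonlin_le hS hκ hu hn) hn
  induction n with
  | zero =>
    have h0 : ∀ x ∈ closure S.dom, |u 0 x| ≤ 1 := fun x hx => by
      rw [h.init x hx]
      exact hu₁ x hx
    exact ⟨h0, hpred 0 h0⟩
  | succ n ih =>
    have hu := h.continuousOn hτ hu₀ n
    have hp := (h.predictor n).continuousOn hτ
    have h1 : ∀ x ∈ closure S.dom, |u (n + 1) x| ≤ 1 := by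
      refine (h.corrector n).abs_le_one hS hκ0 hτ
        (continuousOn_interp_source (continuousOn_nonlin hu) (continuousOn_nonlin hp))
        (fun s hs x hx => ?_) ih.1
      have b1 := abs_nonlin_le hS hκ hu ih.1 x hx
      have b2 := abs_nonlin_le hS hκ hp ih.2 x hx
      have t0 : 0 ≤ s / τ := div_nonneg hs.1 hτ.le
      have t1 : 0 ≤ 1 - s / τ := sub_nonneg.2 (div_le_one_of_le₀ hs.2 hτ.le)
      calc |(1 - s / τ) * nonlin S κ (u n) x + s / τ * nonlin S κ (p (n + 1)) x|
          ≤ (1 - s / τ) * |nonlin S κ (u n) x| + s / τ * |nonlin S κ (p (n + 1)) x| := by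
            refine (abs_add_le _ _).trans_eq ?_
            rw [abs_mul, abs_mul, abs_of_nonneg t0, abs_of_nonneg t1]
        _ ≤ (1 - s / τ) * κ + s / τ * κ := by gcongr
        _ = κ := by ring
    exact ⟨h1, hpred (n + 1) h1⟩

end IsETDRK2

end MassAC

/-- Mass conservation of the ETDRK2 scheme. First conjunct: for every `κ > 0` and every continuous
initial value, as soon as the nonlinear terms are defined. Second conjunct: under the standing
assumptions `κ ≥ 4`, `‖u₀‖ ≤ 1`, `|M₀| ≠ |Ω|` they always are defined, and mass is conserved. -/
theorem mainTheorem6 {d : ℕ} (hd : 0 < d) (S : MassAC.BVSetting d) (hS : S.IsAdmissible)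
    (ε κ τ : ℝ) (hε : 0 < ε) (hκ : 0 < κ) (hτ : 0 < τ)
    (u₀ : MassAC.Pt d → ℝ) (hu₀ : S.IsState u₀) (u p : ℕ → MassAC.Pt d → ℝ)
    (h : MassAC.IsETDRK2 S ε κ τ u₀ u p) :
    (MassAC.NonlinDefined S u p → ∀ n : ℕ, ∫ x in S.dom, u n x = ∫ x in S.dom, u₀ x) ∧
    (4 ≤ κ → (∀ x ∈ closure S.dom, |u₀ x| ≤ 1) →
      |∫ x in S.dom, u₀ x| ≠ (volume S.dom).toReal →
      MassAC.NonlinDefined S u p ∧ ∀ n : ℕ, ∫ x in S.dom, u n x = ∫ x in S.dom, u₀ x) := by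
  have h0 : ∫ x in S.dom, u 0 x = ∫ x in S.dom, u₀ x :=
    setIntegral_congr_fun (MassAC.BVSetting.measurableSet_dom hS)
      fun x hx => h.init x (subset_closure hx)
  have hcons : MassAC.NonlinDefined S u p →
      ∀ n : ℕ, ∫ x in S.dom, u n x = ∫ x in S.dom, u₀ x := by
    intro hdef n
    induction n with
    | zero => exact h0
    | succ n ih => rw [h.integral_succ hS hτ hu₀ n (hdef n).1 (hdef n).2, ih]
  refine ⟨hcons, fun hκ4 hu₁ hM => ?_⟩
  have hb := h.abs_le_one hS hτ hκ4 hu₀ hu₁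
  have hu : ∀ n, ∫ x in S.dom, u n x = ∫ x in S.dom, u₀ x → MassAC.gMass S (u n) ≠ 0 :=
    fun n hn => MassAC.gMass_ne_zero hS (h.continuousOn hτ hu₀ n) (hb n).1 (by rwa [hn])
  have hp : ∀ n, ∫ x in S.dom, u n x = ∫ x in S.dom, u₀ x → MassAC.gMass S (p (n + 1)) ≠ 0 :=
    fun n hn => MassAC.gMass_ne_zero hS ((h.predictor n).continuousOn hτ) (hb n).2 (by
      rwa [h.integral_predictor hS hτ hu₀ n (hu n hn), hn])
  have hmass : ∀ n : ℕ, ∫ x in S.dom, u n x = ∫ x in S.dom, u₀ x := by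
    intro n
    induction n with
    | zero => exact h0
    | succ n ih => rw [h.integral_succ hS hτ hu₀ n (hu n ih) (hp n ih), ih]
  exact ⟨fun n => ⟨hu n (hmass n), hp n (hmass n)⟩, hmass⟩
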